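/- Let $k$ be an algebraically closed field, $n\ge 0$, and let $\mathbf q=(q_{ij})$ be an $n\times n$ matrix with entries in $k^\times$ such that $q_{ii}=1$ and $q_{ji}=q_{ij}^{-1}$ for all $i,j$. Let $A=\mathcal O_{\mathbf q}((k^\times)^n)$ be the quantum torus, i.e. the $k$-algebra generated by $x_1^{\pm1},\dots,x_n^{\pm1}$ subject only to the relations $x_ix_j=q_{ij}x_jx_i$. Put $\Gamma=\mathbb Z^n$ with standard basis $\epsilon_1,\dots,\epsilon_n$, let $\sigma(\alpha,\beta)=\prod_{i,j}q_{ij}^{\alpha_i\beta_j}$ for $\alpha,\beta\in\Gamma$, and let $S=\{\alpha\in\Gamma\mid\sigma(\alpha,\beta)=1\text{ for all }\beta\in\Gamma\}$. Let $c:\Gamma\times\Gamma\to k^\times$ be a 2-cocycle (for the trivial action) with $c(\alpha,\beta)c(\beta,\alpha)^{-1}=\sigma(\alpha,\beta)$ for all $\alpha,\beta\in\Gamma$. Let $k^c\Gamma$ be the twisted group algebra, with $k$-basis $(x_\alpha)_{\alpha\in\Gamma}$ and product $x_\alpha x_\beta=c(\alpha,\beta)x_{\alpha+\beta}$. The assignment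 $x_i\mapsto x_{\epsilon_i}$ defines an isomorphism of $k$-algebras $A\to k^c\Gamma$, and $A$ is identified with $k^c\Gamma$ through it. Let $k\Gamma$ be the group algebra, with basis $(y_\alpha)_{\alpha\in\Gamma}$ and $y_\alpha y_\beta=y_{\alpha+\beta}$, and let $\Phi_c:A\to k\Gamma$ be the $k$-linear isomorphism with $\Phi_c(x_\alpha)=y_\alpha$ for all $\alpha\in\Gamma$. The group $H=\operatorname{Hom}(\Gamma,k^\times)$ acts on $A$ and on $k\Gamma$ by $k$-algebra automorphisms, $h.x_\alpha=h(\alpha)x_\alpha$ and $h.y_\alpha=h(\alpha)y_\alpha$; the map $\Phi_c$ is $H$-equivariant. Let $S^\perp=\{h\in H\mid h(\alpha)=1\text{ for all }\alpha\in S\}$. An *$S^\perp$-ideal* of $k\Gamma$ is an ideal $I$ with $g(I)=I$ for all $g\in S^\perp$. Let $S^\perp\text{-}\operatorname{spec}k\Gamma$ be the set of $S^\perp$-prime ideals, i.e. the proper $S^\perp$-ideals $Q$ such that $IJ\not\subseteq Q$ for all $S^\perp$-ideals $I,J\not\subseteq Q$, and let $S^\perp\text{-}\operatorname{max}k\Gamma$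 be its subset of maximal proper $S^\perp$-ideals. Let $\operatorname{spec}A$ and $\operatorname{max}A$ be the sets of prime and of maximal (two-sided) ideals of $A$. The closed subsets of $\operatorname{spec}A$ (respectively of $S^\perp\text{-}\operatorname{spec}k\Gamma$) are the sets of all members containing a given ideal of $A$ (respectively of $k\Gamma$), and $\operatorname{max}A$ and $S^\perp\text{-}\operatorname{max}k\Gamma$ have the relative topologies. The group $H$ acts on all these sets of ideals by $h.I=h(I)$. **Proposition.** Assume that $c(\alpha,\beta)=1$ for all $\alpha\in S$ and $\beta\in\Gamma$. Then $I\mapsto\Phi_c(I)$ is an isomorphism from the lattice of two-sided ideals of $A$ onto the lattice of $S^\perp$-ideals of $k\Gamma$, which is $H$-equivariant, $\Phi_c(h(I))=h(\Phi_c(I))$, and preserves products, $\Phi_c(IJ)=\Phi_c(I)\Phi_c(J)$; its inverse is $J\mapsto\Phi_c^{-1}(J)$. Moreover, $P\mapsto\Phi_c(P)$ and $Q\mapsto\Phi_c^{-1}(Q)$ are mutually inverse $H$-equivariant homeomorphisms $$\operatorname{spec}A\longleftrightarrow S^\perp\text{-}\operatorname{spec}k\Gamma\qquad\text{and}\qquad\operatorname{max}A\longleftrightarrow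 S^\perp\text{-}\operatorname{max}k\Gamma .$$ -/

import Mathlib

noncomputable section

namespace QTorus

universe u v

/-! ### Two-sided ideals, group actions, prime and maximal spectra -/

section Ideals

variable {R : Type u} [Ring R]

/-- The product `I J` of two ideals: the ideal generated by all products `a * b` with `a ∈ I` and
`b ∈ J`. (Since `I` and `J` are two-sided, this is the set of finite sums of such products.) -/
def idealMul (I J : TwoSidedIdeal R) : TwoSidedIdeal R :=
  TwoSidedIdeal.span {x : R | ∃ a ∈ I, ∃ b ∈ J, a * b = x}

theorem idealMul_le_iff {I J Q : TwoSidedIdeal R} :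
    idealMul I J ≤ Q ↔ ∀ a ∈ I, ∀ b ∈ J, a * b ∈ Q := by
  unfold idealMul
  rw [TwoSidedIdeal.span_le]
  constructor
  · intro h a ha b hb
    exact h ⟨a, ha, b, hb, rfl⟩
  · rintro h x ⟨a, ha, b, hb, rfl⟩
    exact h a ha b hb

/-- `IsPrimeIn L Q`: the ideal `Q` is prime relative to the family `L` of ideals, that is, `Q` is a
proper member of `L`, and `I J ⊄ Q` for all members `I`, `J` of `L` not contained in `Q`.
For `L = ⊤` (all ideals) these are the prime ideals of `R`; if `L` consists of the ideals stable
under a group `G`, they are the `G`-prime ideals. -/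
structure IsPrimeIn (L : CompleteSublattice (TwoSidedIdeal R)) (Q : TwoSidedIdeal R) : Prop where
  mem : Q ∈ L
  ne_top : Q ≠ ⊤
  le_or_le : ∀ I ∈ L, ∀ J ∈ L, idealMul I J ≤ Q → I ≤ Q ∨ J ≤ Q

/-- `IsMaxIn L M`: the ideal `M` is maximal among the proper members of `L`. -/
structure IsMaxIn (L : CompleteSublattice (TwoSidedIdeal R)) (M : TwoSidedIdeal R) : Prop where
  mem : M ∈ L
  ne_top : M ≠ ⊤
  eq_top_of_lt : ∀ J ∈ L, M < J → J = ⊤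

theorem IsMaxIn.isPrimeIn {L : CompleteSublattice (TwoSidedIdeal R)} {M : TwoSidedIdeal R}
    (hM : IsMaxIn L M) : IsPrimeIn L M := by
  refine ⟨hM.mem, hM.ne_top, fun I hI J hJ hIJ => ?_⟩
  by_contra! hcon
  have key : ∀ K ∈ L, ¬ K ≤ M → (1 : R) ∈ M ⊔ K := by
    intro K hK hKM
    have h1 : M ⊔ K = ⊤ := by
      refine hM.eq_top_of_lt _ (L.supClosed' hM.mem hK) (lt_of_le_of_ne le_sup_left ?_)
      intro h
      exact hKM (h ▸ le_sup_right)
    rw [h1]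
    exact TwoSidedIdeal.mem_top R
  obtain ⟨m, hm, a, ha, h1⟩ := TwoSidedIdeal.mem_sup.1 (key I hI hcon.1)
  obtain ⟨m', hm', b, hb, h2⟩ := TwoSidedIdeal.mem_sup.1 (key J hJ hcon.2)
  apply hM.ne_top
  rw [← TwoSidedIdeal.one_mem_iff]
  have h3 : (1 : R) = m * (m' + b) + a * m' + a * b := by
    rw [h2]
    have : a * m' + a * b = a := by rw [← mul_add, h2, mul_one]
    rw [add_assoc, this, mul_one, h1]
  rw [h3]
  exact TwoSidedIdeal.add_mem _ (TwoSidedIdeal.add_mem _ (TwoSidedIdeal.mul_mem_right _ _ _ hm)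
    (TwoSidedIdeal.mul_mem_left _ _ _ hm')) (idealMul_le_iff.1 hIJ a ha b hb)

/-- The set of ideals which are prime relative to `L`. -/
def PrimeSpec (L : CompleteSublattice (TwoSidedIdeal R)) : Type u :=
  {Q : TwoSidedIdeal R // IsPrimeIn L Q}

/-- The set of maximal proper members of `L`. -/
def MaxSpec (L : CompleteSublattice (TwoSidedIdeal R)) : Type u :=
  {M : TwoSidedIdeal R // IsMaxIn L M}

/-- The prime spectrum of a (not necessarily commutative) ring. -/
abbrev Spec (R : Type u) [Ring R] : Type u := PrimeSpec (⊤ : CompleteSublattice (TwoSidedIdeal R))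

/-- The maximal (two-sided) ideals of a ring. -/
abbrev MaxIdeals (R : Type u) [Ring R] : Type u :=
  MaxSpec (⊤ : CompleteSublattice (TwoSidedIdeal R))

/-- The closed set `V(I)`: the relative primes containing a given ideal `I` of `R`. -/
def PrimeSpec.V {L : CompleteSublattice (TwoSidedIdeal R)} (I : TwoSidedIdeal R) :
    Set (PrimeSpec L) :=
  {Q | I ≤ Q.1}

/-- The Zariski topology: the closed sets are precisely the sets `V(I)`, for ideals `I` of `R`. -/
instance (L : CompleteSublattice (TwoSidedIdeal R)) : TopologicalSpace (PrimeSpec L) :=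
  TopologicalSpace.ofClosed {Z : Set (PrimeSpec L) | ∃ I : TwoSidedIdeal R, Z = PrimeSpec.V I}
    ⟨⊤, by
      symm
      rw [Set.eq_empty_iff_forall_notMem]
      intro Q hQ
      exact Q.2.ne_top (top_le_iff.1 hQ)⟩
    (by
      intro A hA
      refine ⟨sSup {I | PrimeSpec.V I ∈ A}, ?_⟩
      ext Q
      constructor
      · intro hQ
        exact (sSup_le fun I hI => hQ _ hI : sSup {I | PrimeSpec.V I ∈ A} ≤ Q.1)
      · intro hQ Z hZ
        obtain ⟨I, rfl⟩ := hA hZ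
        exact (le_sSup (a := I) hZ).trans (show sSup {I | PrimeSpec.V I ∈ A} ≤ Q.1 from hQ))
    (by
      rintro _ ⟨I, rfl⟩ _ ⟨J, rfl⟩
      -- replace an ideal by the smallest member of `L` containing it
      let hull : TwoSidedIdeal R → TwoSidedIdeal R := fun I => sInf {K | K ∈ L ∧ I ≤ K}
      have hmem : ∀ I, hull I ∈ L := fun I => L.sInfClosed' fun K hK => hK.1
      have hle : ∀ I, I ≤ hull I := fun I => le_sInf fun K hK => hK.2
      refine ⟨hull I ⊓ hull J, ?_⟩
      ext Q
      constructor
      · rintro (hQ | hQ)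
        · exact (inf_le_left.trans (sInf_le ⟨Q.2.mem, hQ⟩) : hull I ⊓ hull J ≤ Q.1)
        · exact (inf_le_right.trans (sInf_le ⟨Q.2.mem, hQ⟩) : hull I ⊓ hull J ≤ Q.1)
      · intro hQ
        have h : idealMul (hull I) (hull J) ≤ Q.1 := by
          rw [idealMul_le_iff]
          intro a ha b hb
          exact hQ ((TwoSidedIdeal.mem_inf R).2 ⟨TwoSidedIdeal.mul_mem_right _ _ _ ha,
            TwoSidedIdeal.mul_mem_left _ _ _ hb⟩)
        rcases Q.2.le_or_le _ (hmem I) _ (hmem J) h with h | h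
        · exact Or.inl ((hle I).trans h)
        · exact Or.inr ((hle J).trans h))

theorem PrimeSpec.isClosed_iff {L : CompleteSublattice (TwoSidedIdeal R)} {Z : Set (PrimeSpec L)} :
    IsClosed Z ↔ ∃ I : TwoSidedIdeal R, Z = PrimeSpec.V I := by
  rw [← isOpen_compl_iff]
  change (Zᶜᶜ ∈ {Z : Set (PrimeSpec L) | ∃ I : TwoSidedIdeal R, Z = PrimeSpec.V I}) ↔ _
  rw [compl_compl]
  rfl

/-- Maximal proper members of `L` are prime relative to `L`. -/
def MaxSpec.toPrimeSpec {L : CompleteSublattice (TwoSidedIdeal R)} (M : MaxSpec L) : PrimeSpec L :=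
  ⟨M.1, M.2.isPrimeIn⟩

/-- The relative topology on the set of maximal proper members of `L`. -/
instance (L : CompleteSublattice (TwoSidedIdeal R)) : TopologicalSpace (MaxSpec L) :=
  TopologicalSpace.induced MaxSpec.toPrimeSpec inferInstance

variable {k : Type v} [CommSemiring k] [Algebra k R]

/-- The image `φ(I)` of an ideal `I` under an automorphism `φ`. -/
def imageIdeal (φ : R ≃ₐ[k] R) : TwoSidedIdeal R ≃o TwoSidedIdeal R :=
  (φ : R ≃+* R).mapTwoSidedIdeal

theorem mem_imageIdeal (φ : R ≃ₐ[k] R) (I : TwoSidedIdeal R) (x : R) :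
    x ∈ imageIdeal φ I ↔ φ.symm x ∈ I := by
  rw [imageIdeal, RingEquiv.mapTwoSidedIdeal_apply, TwoSidedIdeal.mem_comap]
  rfl

theorem coe_imageIdeal (φ : R ≃ₐ[k] R) (I : TwoSidedIdeal R) :
    (imageIdeal φ I : Set R) = φ '' (I : Set R) := by
  ext x
  rw [SetLike.mem_coe, mem_imageIdeal]
  constructor
  · intro hx
    exact ⟨φ.symm x, hx, φ.apply_symm_apply x⟩
  · rintro ⟨y, hy, rfl⟩
    rwa [φ.symm_apply_apply]

theorem imageIdeal_mul (φ ψ : R ≃ₐ[k] R) (I : TwoSidedIdeal R) :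
    imageIdeal (φ * ψ) I = imageIdeal φ (imageIdeal ψ I) := by
  ext x
  rw [mem_imageIdeal, mem_imageIdeal, mem_imageIdeal]
  rfl

theorem imageIdeal_idealMul (φ : R ≃ₐ[k] R) (I J : TwoSidedIdeal R) :
    imageIdeal φ (idealMul I J) = idealMul (imageIdeal φ I) (imageIdeal φ J) := by
  have hle : ∀ (ψ : R ≃ₐ[k] R) (I J : TwoSidedIdeal R),
      idealMul (imageIdeal ψ I) (imageIdeal ψ J) ≤ imageIdeal ψ (idealMul I J) := by
    intro ψ I J
    rw [idealMul_le_iff]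
    intro a ha b hb
    rw [mem_imageIdeal] at ha hb ⊢
    rw [map_mul]
    exact idealMul_le_iff.1 (le_refl (idealMul I J)) _ ha _ hb
  have hinv : ∀ I : TwoSidedIdeal R, imageIdeal φ.symm (imageIdeal φ I) = I := by
    intro I
    ext x
    rw [mem_imageIdeal, mem_imageIdeal]
    simp
  have hinv' : ∀ I : TwoSidedIdeal R, imageIdeal φ (imageIdeal φ.symm I) = I := by
    intro I
    ext x
    rw [mem_imageIdeal, mem_imageIdeal]
    simp
  refine le_antisymm ?_ (hle φ I J)
  have h := (imageIdeal φ).monotone (hle φ.symm (imageIdeal φ I) (imageIdeal φ J))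
  rwa [hinv, hinv, hinv'] at h

/-- An automorphism which preserves the family `L` permutes the relative primes. -/
def PrimeSpec.act {L : CompleteSublattice (TwoSidedIdeal R)} (φ : R ≃ₐ[k] R)
    (hφ : ∀ I, imageIdeal φ I ∈ L ↔ I ∈ L) (Q : PrimeSpec L) : PrimeSpec L :=
  ⟨imageIdeal φ Q.1, by
    refine ⟨(hφ _).2 Q.2.mem, ?_, ?_⟩
    · intro h
      exact Q.2.ne_top ((imageIdeal φ).injective (h.trans (map_top _).symm))
    · intro I hI J hJ hIJ
      obtain ⟨I, rfl⟩ := (imageIdeal φ).surjective I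
      obtain ⟨J, rfl⟩ := (imageIdeal φ).surjective J
      rw [← imageIdeal_idealMul, OrderIso.le_iff_le] at hIJ
      rw [OrderIso.le_iff_le, OrderIso.le_iff_le]
      exact Q.2.le_or_le I ((hφ I).1 hI) J ((hφ J).1 hJ) hIJ⟩

/-- An automorphism which preserves the family `L` permutes the maximal proper members of `L`. -/
def MaxSpec.act {L : CompleteSublattice (TwoSidedIdeal R)} (φ : R ≃ₐ[k] R)
    (hφ : ∀ I, imageIdeal φ I ∈ L ↔ I ∈ L) (M : MaxSpec L) : MaxSpec L :=
  ⟨imageIdeal φ M.1, by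
    refine ⟨(hφ _).2 M.2.mem, ?_, ?_⟩
    · intro h
      exact M.2.ne_top ((imageIdeal φ).injective (h.trans (map_top _).symm))
    · intro J hJ hlt
      obtain ⟨J, rfl⟩ := (imageIdeal φ).surjective J
      rw [OrderIso.lt_iff_lt] at hlt
      rw [M.2.eq_top_of_lt J ((hφ J).1 hJ) hlt, map_top]⟩

theorem imageIdeal_mem_top (φ : R ≃ₐ[k] R) (I : TwoSidedIdeal R) :
    imageIdeal φ I ∈ (⊤ : CompleteSublattice (TwoSidedIdeal R)) ↔
      I ∈ (⊤ : CompleteSublattice (TwoSidedIdeal R)) :=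
  ⟨fun _ => trivial, fun _ => trivial⟩

variable {K : Type*} [CommGroup K]

/-- The lattice of `G`-ideals of `R`: the ideals `I` with `g(I) = I` for all `g ∈ G`. Here `G` is a
subgroup of a group `K` which acts on `R` via `ρ`. Sums and intersections are those of ideals. -/
def stableIdeals (ρ : K →* (R ≃ₐ[k] R)) (G : Subgroup K) :
    CompleteSublattice (TwoSidedIdeal R) :=
  CompleteSublattice.mk' {I | ∀ g ∈ G, imageIdeal (ρ g) I = I}
    (by
      intro s hs g hg
      rw [OrderIso.map_sSup, sSup_eq_iSup]
      exact iSup_congr fun I => iSup_congr fun hI => hs hI g hg)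
    (by
      intro s hs g hg
      rw [OrderIso.map_sInf, sInf_eq_iInf]
      exact iInf_congr fun I => iInf_congr fun hI => hs hI g hg)

/-- Since `K` is abelian, its action permutes the `G`-ideals. -/
theorem imageIdeal_mem_stableIdeals (ρ : K →* (R ≃ₐ[k] R)) (G : Subgroup K) (h : K)
    (I : TwoSidedIdeal R) :
    imageIdeal (ρ h) I ∈ stableIdeals ρ G ↔ I ∈ stableIdeals ρ G := by
  have comm : ∀ g, imageIdeal (ρ g) (imageIdeal (ρ h) I)
      = imageIdeal (ρ h) (imageIdeal (ρ g) I) := by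
    intro g
    rw [← imageIdeal_mul, ← imageIdeal_mul, ← map_mul, ← map_mul, mul_comm]
  constructor
  · intro H g hg
    apply (imageIdeal (ρ h)).injective
    rw [← comm]
    exact H g hg
  · intro H g hg
    rw [comm]
    exact congrArg _ (H g hg)

end Ideals

/-! ### Cocycles and twisted group algebras -/

section Twisted

variable {Γ : Type u} [AddCommGroup Γ] {k : Type v} [Field k]

/-- A 2-cocycle on `Γ` with values in `kˣ` (for the trivial action). -/
structure TwoCocycle (Γ : Type u) [AddCommGroup Γ] (k : Type v) [Field k] where
  toFun : Γ → Γ → kˣ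
  cocycle : ∀ α β γ, toFun α β * toFun (α + β) γ = toFun β γ * toFun α (β + γ)

instance : CoeFun (TwoCocycle Γ k) (fun _ => Γ → Γ → kˣ) := ⟨TwoCocycle.toFun⟩

/-- The twisted group algebra `k^c Γ`: the `k`-vector space with basis `x_α`, `α ∈ Γ`, and
multiplication `x_α x_β = c(α, β) x_(α + β)`. -/
def TwistedGroupAlgebra (_c : TwoCocycle Γ k) : Type (max u v) := Γ →₀ k

namespace TwistedGroupAlgebra

variable (c : TwoCocycle Γ k)

instance : AddCommGroup (TwistedGroupAlgebra c) := inferInstanceAs (AddCommGroup (Γ →₀ k))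

instance : Module k (TwistedGroupAlgebra c) := inferInstanceAs (Module k (Γ →₀ k))

/-- The basis element `x_α`. -/
def x (α : Γ) : TwistedGroupAlgebra c := (Finsupp.single α (1 : k) : Γ →₀ k)

/-- The basis `(x_α)`. -/
def basis : Module.Basis Γ k (TwistedGroupAlgebra c) := Module.Basis.ofRepr (LinearEquiv.refl k _)

theorem basis_apply (α : Γ) : basis c α = x c α := rfl

/-- The bilinear multiplication of `k^c Γ`. -/
def mulLin : TwistedGroupAlgebra c →ₗ[k] TwistedGroupAlgebra c →ₗ[k] TwistedGroupAlgebra c :=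
  (basis c).constr k fun α => (basis c).constr k fun β => (c α β : k) • x c (α + β)

instance : Mul (TwistedGroupAlgebra c) := ⟨fun a b => mulLin c a b⟩

/-- The identity element is `c(0,0)⁻¹ x_0`. -/
instance : One (TwistedGroupAlgebra c) := ⟨(↑(c 0 0)⁻¹ : k) • x c 0⟩

theorem mul_def (a b : TwistedGroupAlgebra c) : a * b = mulLin c a b := rfl

theorem one_def : (1 : TwistedGroupAlgebra c) = (↑(c 0 0)⁻¹ : k) • x c 0 := rfl

theorem x_mul_x (α β : Γ) : x c α * x c β = (c α β : k) • x c (α + β) := by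
  rw [mul_def, mulLin, ← basis_apply, ← basis_apply, Module.Basis.constr_basis,
    Module.Basis.constr_basis]

theorem smul_mul' (r : k) (a b : TwistedGroupAlgebra c) : (r • a) * b = r • (a * b) := by
  simp only [mul_def, map_smul, LinearMap.smul_apply]

theorem mul_smul' (r : k) (a b : TwistedGroupAlgebra c) : a * (r • b) = r • (a * b) := by
  simp only [mul_def, map_smul]

theorem cocycle_zero_left (β : Γ) : c 0 β = c 0 0 := by
  have h := c.cocycle 0 0 β
  simp only [zero_add, add_zero] at h
  exact (mul_right_cancel h).symm

theorem cocycle_zero_right (α : Γ) : c α 0 = c 0 0 := by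
  have h := c.cocycle α 0 0
  simp only [add_zero] at h
  exact mul_right_cancel h

theorem mul_assoc' (a b d : TwistedGroupAlgebra c) : a * b * d = a * (b * d) := by
  have key : ∀ α β γ, x c α * x c β * x c γ = x c α * (x c β * x c γ) := by
    intro α β γ
    rw [x_mul_x, x_mul_x, smul_mul', mul_smul', x_mul_x, x_mul_x, smul_smul, smul_smul, add_assoc]
    congr 1
    exact_mod_cast congrArg Units.val (c.cocycle α β γ)
  have h1 : ∀ α β, (mulLin c (x c α * x c β)) = (mulLin c (x c α)) ∘ₗ (mulLin c (x c β)) :=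
    fun α β => (basis c).ext fun γ => key α β γ
  have h2 : ∀ α, (LinearMap.lcomp k _ (LinearMap.id)) ((mulLin c) ∘ₗ (mulLin c (x c α)))
      = (LinearMap.llcomp k _ _ _ (mulLin c (x c α))) ∘ₗ (mulLin c) :=
    fun α => (basis c).ext fun β => h1 α β
  have h3 : ∀ b d : TwistedGroupAlgebra c,
      ((mulLin c).flip d) ∘ₗ ((mulLin c).flip b) = (mulLin c).flip (mulLin c b d) :=
    fun b d => (basis c).ext fun α => LinearMap.congr_fun (LinearMap.congr_fun (h2 α) b) d
  exact LinearMap.congr_fun (h3 b d) a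

theorem one_mul' (a : TwistedGroupAlgebra c) : 1 * a = a := by
  have h : mulLin c 1 = LinearMap.id := (basis c).ext fun α => by
    change 1 * x c α = x c α
    rw [one_def, smul_mul', x_mul_x, smul_smul, zero_add, cocycle_zero_left c α, Units.inv_mul, one_smul]
  exact LinearMap.congr_fun h a

theorem mul_one' (a : TwistedGroupAlgebra c) : a * 1 = a := by
  have h : (mulLin c).flip 1 = LinearMap.id := (basis c).ext fun α => by
    change x c α * 1 = x c α
    rw [one_def, mul_smul', x_mul_x, smul_smul, add_zero, cocycle_zero_right c α, Units.inv_mul, one_smul]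
  exact LinearMap.congr_fun h a

instance : Ring (TwistedGroupAlgebra c) :=
  { (inferInstance : AddCommGroup (TwistedGroupAlgebra c)),
    (inferInstance : Mul (TwistedGroupAlgebra c)),
    (inferInstance : One (TwistedGroupAlgebra c)) with
    left_distrib := fun a b d => by simp only [mul_def, map_add]
    right_distrib := fun a b d => by simp only [mul_def, map_add, LinearMap.add_apply]
    zero_mul := fun a => by simp only [mul_def, map_zero, LinearMap.zero_apply]
    mul_zero := fun a => by simp only [mul_def, map_zero]
    mul_assoc := mul_assoc' c
    one_mul := one_mul' c
    mul_one := mul_one' c }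

instance : Algebra k (TwistedGroupAlgebra c) := Algebra.ofModule (smul_mul' c) (mul_smul' c)

theorem x_mul_x_neg (α : Γ) :
    x c α * ((↑((c α (-α))⁻¹ * (c 0 0)⁻¹) : k) • x c (-α)) = 1 := by
  rw [mul_smul', x_mul_x, smul_smul, add_neg_cancel, one_def]
  congr 1
  rw [← Units.val_mul, mul_right_comm, inv_mul_cancel, one_mul]

theorem x_neg_mul_x (α : Γ) :
    ((↑((c α (-α))⁻¹ * (c 0 0)⁻¹) : k) • x c (-α)) * x c α = 1 := by
  have h : c (-α) α = c α (-α) := by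
    have h := c.cocycle α (-α) α
    rw [add_neg_cancel, neg_add_cancel, cocycle_zero_left, cocycle_zero_right c α] at h
    exact (mul_right_cancel h).symm
  rw [smul_mul', x_mul_x, smul_smul, neg_add_cancel, one_def, h]
  congr 1
  rw [← Units.val_mul, mul_right_comm, inv_mul_cancel, one_mul]

end TwistedGroupAlgebra

end Twisted

/-! ### Quantum tori -/

section Torus

variable {k : Type u} [Field k] {n : ℕ}

/-- `q` is multiplicatively antisymmetric: `q_ii = 1` and `q_ji = q_ij⁻¹`. -/
def IsMulAntisymm (q : Fin n → Fin n → kˣ) : Prop :=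
  (∀ i, q i i = 1) ∧ ∀ i j, q j i = (q i j)⁻¹

/-- The defining relations of the quantum torus in the free algebra on letters `(i, true)`
(standing for `x_i`) and `(i, false)` (standing for `x_i⁻¹`). -/
inductive TorusRel (q : Fin n → Fin n → kˣ) :
    FreeAlgebra k (Fin n × Bool) → FreeAlgebra k (Fin n × Bool) → Prop
  | mul_inv (i : Fin n) : TorusRel q
      (FreeAlgebra.ι k (i, true) * FreeAlgebra.ι k (i, false)) 1
  | inv_mul (i : Fin n) : TorusRel q
      (FreeAlgebra.ι k (i, false) * FreeAlgebra.ι k (i, true)) 1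
  | comm (i j : Fin n) : TorusRel q
      (FreeAlgebra.ι k (i, true) * FreeAlgebra.ι k (j, true))
      ((q i j : k) • (FreeAlgebra.ι k (j, true) * FreeAlgebra.ι k (i, true)))

/-- The multiparameter quantum torus `O_q((kˣ)ⁿ)`: the `k`-algebra generated by
`x_1^{±1}, …, x_n^{±1}` subject only to the relations `x_i x_j = q_ij x_j x_i`. -/
def QuantumTorus (q : Fin n → Fin n → kˣ) : Type u := RingQuot (TorusRel q)

namespace QuantumTorus

variable (q : Fin n → Fin n → kˣ)

instance : Ring (QuantumTorus q) := inferInstanceAs (Ring (RingQuot (TorusRel q)))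

instance : Algebra k (QuantumTorus q) := inferInstanceAs (Algebra k (RingQuot (TorusRel q)))

/-- The generator `x_i`. -/
def gen (i : Fin n) : QuantumTorus q :=
  RingQuot.mkAlgHom k (TorusRel q) (FreeAlgebra.ι k (i, true))

/-- The generator `x_i⁻¹`. -/
def genInv (i : Fin n) : QuantumTorus q :=
  RingQuot.mkAlgHom k (TorusRel q) (FreeAlgebra.ι k (i, false))

theorem gen_mul_genInv (i : Fin n) : gen q i * genInv q i = 1 := by
  have h := RingQuot.mkAlgHom_rel k (TorusRel.mul_inv (q := q) i)
  rw [map_mul, map_one] at h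
  exact h

theorem genInv_mul_gen (i : Fin n) : genInv q i * gen q i = 1 := by
  have h := RingQuot.mkAlgHom_rel k (TorusRel.inv_mul (q := q) i)
  rw [map_mul, map_one] at h
  exact h

theorem gen_mul_gen (i j : Fin n) : gen q i * gen q j = (q i j : k) • (gen q j * gen q i) := by
  have h := RingQuot.mkAlgHom_rel k (TorusRel.comm (q := q) i j)
  rw [map_mul, map_smul, map_mul] at h
  exact h

variable {q}

/-- The universal property of the quantum torus. -/
def lift {B : Type*} [Ring B] [Algebra k B] (f g : Fin n → B) (hfg : ∀ i, f i * g i = 1)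
    (hgf : ∀ i, g i * f i = 1) (hf : ∀ i j, f i * f j = (q i j : k) • (f j * f i)) :
    QuantumTorus q →ₐ[k] B :=
  RingQuot.liftAlgHom k ⟨FreeAlgebra.lift k fun p => if p.2 then f p.1 else g p.1, by
    rintro _ _ (i | i | ⟨i, j⟩)
    · simpa using hfg i
    · simpa using hgf i
    · simpa using hf i j⟩

section lift

variable {B : Type*} [Ring B] [Algebra k B] (f g : Fin n → B) (hfg : ∀ i, f i * g i = 1)
    (hgf : ∀ i, g i * f i = 1) (hf : ∀ i j, f i * f j = (q i j : k) • (f j * f i))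

theorem lift_gen (i : Fin n) : lift f g hfg hgf hf (gen q i) = f i := by
  have h := RingQuot.liftAlgHom_mkAlgHom_apply (S := k)
    (FreeAlgebra.lift k fun p : Fin n × Bool => if p.2 then f p.1 else g p.1) (s := TorusRel q) (by
      rintro _ _ (i | i | ⟨i, j⟩)
      · simpa using hfg i
      · simpa using hgf i
      · simpa using hf i j) (FreeAlgebra.ι k (i, true))
  rw [FreeAlgebra.lift_ι_apply] at h
  exact h

theorem lift_genInv (i : Fin n) : lift f g hfg hgf hf (genInv q i) = g i := by
  have h := RingQuot.liftAlgHom_mkAlgHom_apply (S := k)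
    (FreeAlgebra.lift k fun p : Fin n × Bool => if p.2 then f p.1 else g p.1) (s := TorusRel q) (by
      rintro _ _ (i | i | ⟨i, j⟩)
      · simpa using hfg i
      · simpa using hgf i
      · simpa using hf i j) (FreeAlgebra.ι k (i, false))
  rw [FreeAlgebra.lift_ι_apply] at h
  exact h

end lift

theorem algHom_ext {B : Type*} [Ring B] [Algebra k B] {φ ψ : QuantumTorus q →ₐ[k] B}
    (h : ∀ i, φ (gen q i) = ψ (gen q i)) : φ = ψ := by
  have h' : ∀ i, φ (genInv q i) = ψ (genInv q i) := by
    intro i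
    have h1 : φ (genInv q i) * φ (gen q i) = 1 := by
      rw [← map_mul, genInv_mul_gen, map_one]
    have h2 : φ (gen q i) * ψ (genInv q i) = 1 := by
      rw [h, ← map_mul, gen_mul_genInv, map_one]
    exact left_inv_eq_right_inv h1 h2
  apply RingQuot.ringQuot_ext'
  apply FreeAlgebra.hom_ext
  funext p
  obtain ⟨i, b⟩ := p
  cases b
  · exact h' i
  · exact h i

end QuantumTorus

/-- `σ(α, β) = ∏ q_ij ^ (α_i β_j)`. -/
def sigma (q : Fin n → Fin n → kˣ) (α β : Fin n → ℤ) : kˣ :=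
  ∏ i, ∏ j, q i j ^ (α i * β j)

/-- The radical `S = {α | σ(α, -) ≡ 1}` of `σ`, a subgroup of `Γ = ℤⁿ`. -/
def rad (q : Fin n → Fin n → kˣ) : AddSubgroup (Fin n → ℤ) where
  carrier := {α | ∀ β, sigma q α β = 1}
  zero_mem' := fun β => by simp [sigma]
  add_mem' := fun {a b} ha hb β => by
    have h : sigma q (a + b) β = sigma q a β * sigma q b β := by
      simp [sigma, add_mul, zpow_add, Finset.prod_mul_distrib]
    rw [h, ha, hb, one_mul]
  neg_mem' := fun {a} ha β => by
    have h : sigma q (-a) β = (sigma q a β)⁻¹ := by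
      simp [sigma, zpow_neg, Finset.prod_inv_distrib]
    rw [h, ha, inv_one]

theorem sigma_single (q : Fin n → Fin n → kˣ) (i j : Fin n) :
    sigma q (Pi.single i 1) (Pi.single j 1) = q i j := by
  unfold sigma
  rw [Finset.prod_eq_single i, Finset.prod_eq_single j]
  · simp
  · intro b _ hb
    simp [hb]
  · simp
  · intro b _ hb
    simp [hb]
  · simp

/-- The algebraic torus `H = Hom(Γ, kˣ)`, `Γ = ℤⁿ`. -/
abbrev CharTorus (k : Type u) [Field k] (n : ℕ) : Type u := Multiplicative (Fin n → ℤ) →* kˣ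

/-- The pairing `⟨h, α⟩`. -/
def pairing (h : CharTorus k n) (α : Fin n → ℤ) : kˣ := h (Multiplicative.ofAdd α)

/-- The orthogonal `S^⊥ = {h ∈ H | ⟨h, α⟩ = 1 for all α ∈ S}` of a subgroup `S` of `Γ`. -/
def perp (S : AddSubgroup (Fin n → ℤ)) : Subgroup (CharTorus k n) where
  carrier := {h | ∀ α ∈ S, pairing h α = 1}
  one_mem' := fun _ _ => rfl
  mul_mem' := fun {a b} ha hb α hα => by
    change pairing a α * pairing b α = 1
    rw [ha α hα, hb α hα, one_mul]
  inv_mem' := fun {a} ha α hα => by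
    change (pairing a α)⁻¹ = 1
    rw [ha α hα, inv_one]

/-- A group acting by algebra endomorphisms acts by algebra automorphisms. -/
def toAut {K : Type*} [Group K] {R : Type*} [Ring R] [Algebra k R] (f : K → (R →ₐ[k] R))
    (h1 : f 1 = AlgHom.id k R) (hmul : ∀ a b, f (a * b) = (f a).comp (f b)) :
    K →* (R ≃ₐ[k] R) where
  toFun a := AlgEquiv.ofAlgHom (f a) (f a⁻¹) (by rw [← hmul, mul_inv_cancel, h1])
    (by rw [← hmul, inv_mul_cancel, h1])
  map_one' := by
    ext x
    exact AlgHom.congr_fun h1 x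
  map_mul' a b := by
    ext x
    exact AlgHom.congr_fun (hmul a b) x

/-- The group algebra `kΓ` of `Γ = ℤⁿ`. -/
abbrev GroupAlg (k : Type u) [Field k] (n : ℕ) : Type u := AddMonoidAlgebra k (Fin n → ℤ)

/-- The basis element `y_α` of `kΓ`. -/
def y (k : Type u) [Field k] {n : ℕ} (α : Fin n → ℤ) : GroupAlg k n := AddMonoidAlgebra.single α 1

theorem y_mul_y (α β : Fin n → ℤ) : y k α * y k β = y k (α + β) := by
  simp [y, AddMonoidAlgebra.single_mul_single]

/-- The endomorphism `y_α ↦ ⟨h, α⟩ y_α` of `kΓ`. -/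
def groupAlgHom (h : CharTorus k n) : GroupAlg k n →ₐ[k] GroupAlg k n :=
  AddMonoidAlgebra.lift k (GroupAlg k n) (Fin n → ℤ)
    { toFun := fun α => (pairing h α.toAdd : k) • y k α.toAdd
      map_one' := by
        have : pairing h 0 = 1 := map_one h
        simp only [toAdd_one, this, Units.val_one, one_smul]
        rfl
      map_mul' := fun α β => by
        have : pairing h (α.toAdd + β.toAdd) = pairing h α.toAdd * pairing h β.toAdd :=
          map_mul h α β
        rw [toAdd_mul, this, smul_mul_smul_comm, y_mul_y, Units.val_mul] }

theorem groupAlgHom_y (h : CharTorus k n) (α : Fin n → ℤ) :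
    groupAlgHom h (y k α) = (pairing h α : k) • y k α := by
  unfold groupAlgHom y
  rw [AddMonoidAlgebra.lift_single, one_smul]
  rfl

theorem groupAlg_ext {B : Type*} [Ring B] [Algebra k B] {φ ψ : GroupAlg k n →ₐ[k] B}
    (h : ∀ α, φ (y k α) = ψ (y k α)) : φ = ψ :=
  (AddMonoidAlgebra.lift k B (Fin n → ℤ)).symm.injective (MonoidHom.ext fun α => h α.toAdd)

/-- The action of `H` on `kΓ` by `k`-algebra automorphisms, `h.y_α = ⟨h, α⟩ y_α`. -/
def actGroupAlg (k : Type u) [Field k] (n : ℕ) :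
    CharTorus k n →* (GroupAlg k n ≃ₐ[k] GroupAlg k n) :=
  toAut groupAlgHom
    (groupAlg_ext fun α => by
      rw [groupAlgHom_y]
      change ((1 : kˣ) : k) • _ = _
      simp)
    (fun a b => groupAlg_ext fun α => by
      rw [AlgHom.comp_apply, groupAlgHom_y, groupAlgHom_y, map_smul, groupAlgHom_y, smul_smul]
      change ((pairing a α * pairing b α : kˣ) : k) • _ = _
      rw [Units.val_mul, mul_comm])

/-- The endomorphism `x_i ↦ ⟨h, ε_i⟩ x_i` of the quantum torus. -/
def torusHom (q : Fin n → Fin n → kˣ) (h : CharTorus k n) :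
    QuantumTorus q →ₐ[k] QuantumTorus q :=
  QuantumTorus.lift
    (fun i => (pairing h (Pi.single i 1) : k) • QuantumTorus.gen q i)
    (fun i => (↑(pairing h (Pi.single i 1))⁻¹ : k) • QuantumTorus.genInv q i)
    (fun i => by
      rw [smul_mul_smul_comm, QuantumTorus.gen_mul_genInv, Units.mul_inv, one_smul])
    (fun i => by
      rw [smul_mul_smul_comm, QuantumTorus.genInv_mul_gen, Units.inv_mul, one_smul])
    (fun i j => by
      rw [smul_mul_smul_comm, smul_mul_smul_comm, QuantumTorus.gen_mul_gen, smul_smul, smul_smul]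
      congr 1
      ring)

theorem torusHom_gen (q : Fin n → Fin n → kˣ) (h : CharTorus k n) (i : Fin n) :
    torusHom q h (QuantumTorus.gen q i) =
      (pairing h (Pi.single i 1) : k) • QuantumTorus.gen q i :=
  QuantumTorus.lift_gen ..

/-- The action of `H` on the quantum torus `A` by `k`-algebra automorphisms,
`h.x_i = ⟨h, ε_i⟩ x_i`; equivalently, `h` multiplies each monomial of multidegree `α` by
`⟨h, α⟩`. -/
def actTorus (q : Fin n → Fin n → kˣ) :
    CharTorus k n →* (QuantumTorus q ≃ₐ[k] QuantumTorus q) :=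
  toAut (torusHom q)
    (QuantumTorus.algHom_ext fun i => by
      rw [torusHom_gen]
      change ((1 : kˣ) : k) • _ = _
      simp)
    (fun a b => QuantumTorus.algHom_ext fun i => by
      rw [AlgHom.comp_apply, torusHom_gen, torusHom_gen, map_smul, torusHom_gen, smul_smul]
      change ((pairing a _ * pairing b _ : kˣ) : k) • _ = _
      rw [Units.val_mul, mul_comm])

variable (q : Fin n → Fin n → kˣ) (c : TwoCocycle (Fin n → ℤ) k)
  (hc : ∀ α β, c α β * (c β α)⁻¹ = sigma q α β)

/-- The canonical homomorphism `A → k^c Γ`, `x_i ↦ x_(ε_i)`, through which the quantum torus `A` is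
identified with `k^c Γ`, for a cocycle `c` with `c(α, β) c(β, α)⁻¹ = σ(α, β)`. -/
def toTwisted : QuantumTorus q →ₐ[k] TwistedGroupAlgebra c :=
  QuantumTorus.lift
    (fun i => TwistedGroupAlgebra.x c (Pi.single i 1))
    (fun i => (↑((c (Pi.single i 1) (-Pi.single i 1))⁻¹ * (c 0 0)⁻¹) : k) •
      TwistedGroupAlgebra.x c (-Pi.single i 1))
    (fun i => TwistedGroupAlgebra.x_mul_x_neg c _)
    (fun i => TwistedGroupAlgebra.x_neg_mul_x c _)
    (fun i j => by
      rw [TwistedGroupAlgebra.x_mul_x, TwistedGroupAlgebra.x_mul_x, smul_smul,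
        add_comm (Pi.single j (1 : ℤ) : Fin n → ℤ), ← Units.val_mul, ← sigma_single q i j, ← hc,
        inv_mul_cancel_right])

theorem toTwisted_gen (i : Fin n) :
    toTwisted q c hc (QuantumTorus.gen q i) = TwistedGroupAlgebra.x c (Pi.single i 1) :=
  QuantumTorus.lift_gen ..

/-- The `k`-linear map `Φ_c : A → kΓ` with `Φ_c(x_α) = y_α` for `α ∈ Γ`, where `A` is identified
with `k^c Γ`. -/
def Phi : QuantumTorus q →ₗ[k] GroupAlg k n :=
  ((TwistedGroupAlgebra.basis c).constr k fun α => y k α) ∘ₗ (toTwisted q c hc).toLinearMap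

end Torus

end QTorus

end

noncomputable section

namespace QTorus

universe u v w

/-! ### The identification of the quantum torus with the twisted group algebra -/

section Identification

variable {k : Type u} [Field k] {n : ℕ}

/-! `Φ_c` is not multiplicative, but it matches ideals because both sides consist of ideals
homogeneous for the grading by `Γ/S`.

In `A` the unit `x_β` satisfies `x_β x_α x_β⁻¹ = σ(β,α) x_α`, so every two-sided ideal is preserved
by the diagonal operators of the characters `σ(β,-)`. In `kΓ` these characters lie in `S^⊥`, so an
`S^⊥`-ideal is preserved by the same operators. As `S` is the radical of `σ`, the `σ(β,-)` separate
the cosets of `S`; Lagrange interpolation on the finite support of an element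
(`isCosetHomogeneous_of_separates`) then shows that such an ideal contains the `Γ/S`-components of
its elements. Conversely, elements of `S^⊥` are constant on cosets, so homogeneous ideals of `kΓ`
are `S^⊥`-stable (`mem_stableIdeals_iff`).

The normalisation of `c` on `S × Γ` and the cocycle identity make `c` constant on cosets in both
variables. Hence for `y` in a single component, of coset `p`, the element `Φ_c(x) Φ_c(y)` equals
`Φ_c(x' y)`, where `x'` arises from `x` by a diagonal operator constant on cosets. If `x` and `y`
lie in homogeneous ideals `I` and `J`, then so do `x'` and `y`, whence `Φ_c(I) Φ_c(J) ⊆ Φ_c(IJ)`.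
The case where one factor is the whole ring says that `Φ_c` of an ideal is an ideal. The argument
(`map_mul_map_mem`) is symmetric in the two algebras, so it applies to `Φ_c⁻¹` as well. Spectra and
their topologies depend only on the lattice and its product.

The identification of `A` with `k^c Γ` avoids ordered monomials: the generators commute modulo
scalars, which gives a homomorphism from `Γ` to units modulo scalars, and the remaining scalar is
read off in `k^c Γ`. -/

/-- The subgroup of nonzero scalars in the unit group of an algebra. -/
def scalarUnits (k : Type u) [Field k] (B : Type w) [Ring B] [Algebra k B] : Subgroup Bˣ :=
  (Units.map (algebraMap k B : k →* B)).range

theorem mem_scalarUnits {B : Type w} [Ring B] [Algebra k B] {b : Bˣ} :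
    b ∈ scalarUnits k B ↔ ∃ r : kˣ, (b : B) = algebraMap k B r := by
  constructor
  · rintro ⟨r, rfl⟩
    exact ⟨r, rfl⟩
  · rintro ⟨r, hr⟩
    exact ⟨r, Units.ext hr.symm⟩

instance (B : Type w) [Ring B] [Algebra k B] : (scalarUnits k B).Normal where
  conj_mem := by
    rintro b hb g
    obtain ⟨r, hr⟩ := mem_scalarUnits.1 hb
    refine mem_scalarUnits.2 ⟨r, ?_⟩
    rw [Units.val_mul, Units.val_mul, hr, ← Algebra.commutes, mul_assoc, Units.mul_inv, mul_one]

/-! ### Monomials of the quantum torus up to scalars -/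

variable (q : Fin n → Fin n → kˣ)

/-- The generator `x_i` as a unit of the quantum torus. -/
def genUnit (i : Fin n) : (QuantumTorus q)ˣ :=
  ⟨QuantumTorus.gen q i, QuantumTorus.genInv q i, QuantumTorus.gen_mul_genInv q i,
    QuantumTorus.genInv_mul_gen q i⟩

/-- The factor `q_ij` disappears modulo scalars, so in the quotient a monomial needs no chosen order
of its factors. -/
theorem commute_mk_genUnit (i j : Fin n) :
    Commute (QuotientGroup.mk (s := scalarUnits k (QuantumTorus q)) (genUnit q i))
      (QuotientGroup.mk (genUnit q j)) := by
  change QuotientGroup.mk (genUnit q i * genUnit q j) = QuotientGroup.mk (genUnit q j * genUnit q i)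
  symm
  rw [QuotientGroup.eq]
  refine mem_scalarUnits.2 ⟨q i j, ?_⟩
  have h : ((genUnit q i * genUnit q j : (QuantumTorus q)ˣ) : QuantumTorus q)
      = (genUnit q j * genUnit q i : (QuantumTorus q)ˣ) * algebraMap k _ (q i j : k) := by
    rw [← Algebra.commutes, ← Algebra.smul_def]
    exact QuantumTorus.gen_mul_gen q i j
  rw [Units.val_mul, h, Units.inv_mul_cancel_left]

theorem pairwise_commute_zpowers_genUnit : Pairwise fun i j => ∀ a b : Multiplicative ℤ,
    Commute (zpowersHom ((QuantumTorus q)ˣ ⧸ scalarUnits k (QuantumTorus q))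
        (QuotientGroup.mk (genUnit q i)) a)
      (zpowersHom _ (QuotientGroup.mk (genUnit q j)) b) := by
  intro i j _ a b
  rw [zpowersHom_apply, zpowersHom_apply]
  exact (commute_mk_genUnit q i j).zpow_zpow _ _

/-- The class modulo scalars of the monomials of multidegree `α`. -/
def monomialClass (α : Fin n → ℤ) : (QuantumTorus q)ˣ ⧸ scalarUnits k (QuantumTorus q) :=
  MonoidHom.noncommPiCoprod (N := fun _ : Fin n => Multiplicative ℤ)
    (fun i => zpowersHom _ (QuotientGroup.mk (genUnit q i)))
    (pairwise_commute_zpowers_genUnit q)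
    (fun i => Multiplicative.ofAdd (α i))

theorem monomialClass_add (α β : Fin n → ℤ) :
    monomialClass q (α + β) = monomialClass q α * monomialClass q β :=
  map_mul (MonoidHom.noncommPiCoprod (N := fun _ : Fin n => Multiplicative ℤ) _ _) _ _

theorem monomialClass_zero : monomialClass q 0 = 1 :=
  map_one (MonoidHom.noncommPiCoprod (N := fun _ : Fin n => Multiplicative ℤ) _ _)

theorem monomialClass_single (i : Fin n) :
    monomialClass q (Pi.single i 1) = QuotientGroup.mk (genUnit q i) := by
  have h : (fun j => Multiplicative.ofAdd ((Pi.single i 1 : Fin n → ℤ) j))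
      = Pi.mulSingle (M := fun _ => Multiplicative ℤ) i (Multiplicative.ofAdd 1) := by
    funext j
    by_cases hj : j = i
    · subst hj; simp
    · simp [hj]
  rw [monomialClass, h, MonoidHom.noncommPiCoprod_mulSingle]
  simp

theorem closure_range_single :
    AddSubgroup.closure (Set.range fun i : Fin n => (Pi.single i 1 : Fin n → ℤ)) = ⊤ := by
  rw [eq_top_iff]
  intro α _
  rw [← Finset.univ_sum_single α]
  refine sum_mem fun i _ => ?_
  have h : (Pi.single i (α i) : Fin n → ℤ) = α i • Pi.single i 1 := by
    rw [← Pi.single_smul, smul_eq_mul, mul_one]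
  rw [h]
  exact zsmul_mem (AddSubgroup.subset_closure (Set.mem_range_self i)) _

/-! ### Monomials normalised by their image in the twisted group algebra -/

variable (c : TwoCocycle (Fin n → ℤ) k)
  (hc : ∀ α β, c α β * (c β α)⁻¹ = sigma q α β)

theorem TwistedGroupAlgebra.smul_x_injective {r s : k} {α : Fin n → ℤ}
    (h : r • TwistedGroupAlgebra.x c α = s • TwistedGroupAlgebra.x c α) : r = s :=
  smul_left_injective k ((TwistedGroupAlgebra.basis c).ne_zero α) h

/-- The degrees for which such a unit exists form a subgroup containing every `ε_i`. The same unit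
carries both conditions, which ties its class modulo scalars to its degree in `k^c Γ`. -/
theorem exists_unit_smul_x (α : Fin n → ℤ) : ∃ a : (QuantumTorus q)ˣ,
    QuotientGroup.mk a = monomialClass q α ∧
      ∃ r : kˣ, toTwisted q c hc a = (r : k) • TwistedGroupAlgebra.x c α := by
  have hα : α ∈ AddSubgroup.closure (Set.range fun i : Fin n => (Pi.single i 1 : Fin n → ℤ)) := by
    rw [closure_range_single]; trivial
  induction hα using AddSubgroup.closure_induction with
  | mem x hx =>
    obtain ⟨i, rfl⟩ := hx
    refine ⟨genUnit q i, (monomialClass_single q i).symm, 1, ?_⟩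
    rw [Units.val_one, one_smul]
    exact toTwisted_gen q c hc i
  | zero =>
    -- The cocycle is not normalised here: the identity of `k^c Γ` is `c(0,0)⁻¹ x_0`.
    refine ⟨1, (monomialClass_zero q).symm, (c 0 0)⁻¹, ?_⟩
    rw [Units.val_one, map_one]
    rfl
  | add x y _ _ hx hy =>
    obtain ⟨a, ha, r, hr⟩ := hx
    obtain ⟨b, hb, s, hs⟩ := hy
    refine ⟨a * b, ?_, r * s * c x y, ?_⟩
    · rw [monomialClass_add, ← ha, ← hb]; rfl
    · rw [Units.val_mul, map_mul, hr, hs, smul_mul_smul_comm, TwistedGroupAlgebra.x_mul_x,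
        smul_smul, Units.val_mul, Units.val_mul]
  | neg x _ hx =>
    obtain ⟨a, ha, r, hr⟩ := hx
    -- The last two factors are the scalar by which `x_(-α)` must be multiplied to become the
    -- inverse of `x_α`.
    refine ⟨a⁻¹, ?_, r⁻¹ * ((c x (-x))⁻¹ * (c 0 0)⁻¹), ?_⟩
    · have h := monomialClass_add q x (-x)
      rw [add_neg_cancel, monomialClass_zero, ← ha] at h
      exact (eq_inv_of_mul_eq_one_right h.symm).symm
    · have h1 : toTwisted q c hc ↑a⁻¹ * toTwisted q c hc ↑a = 1 := by
        rw [← map_mul, Units.inv_mul, map_one]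
      have h2 : toTwisted q c hc ↑a * (((r⁻¹ * ((c x (-x))⁻¹ * (c 0 0)⁻¹) : kˣ) : k) •
          TwistedGroupAlgebra.x c (-x)) = 1 := by
        rw [hr, Units.val_mul, mul_smul, smul_mul_smul_comm, Units.mul_inv, one_smul]
        exact TwistedGroupAlgebra.x_mul_x_neg c x
      exact left_inv_eq_right_inv h1 h2

theorem exists_unit_eq_x (α : Fin n → ℤ) : ∃ a : (QuantumTorus q)ˣ,
    QuotientGroup.mk a = monomialClass q α ∧
      toTwisted q c hc a = TwistedGroupAlgebra.x c α := by
  obtain ⟨a, ha, r, hr⟩ := exists_unit_smul_x q c hc α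
  refine ⟨a * Units.map (algebraMap k (QuantumTorus q) : k →* QuantumTorus q) r⁻¹, ?_, ?_⟩
  · rw [← ha, eq_comm, QuotientGroup.eq, inv_mul_cancel_left]
    exact ⟨_, rfl⟩
  · have h : ((a * Units.map (algebraMap k (QuantumTorus q) : k →* QuantumTorus q) r⁻¹ :
        (QuantumTorus q)ˣ) : QuantumTorus q) = ((r⁻¹ : kˣ) : k) • (a : QuantumTorus q) := by
      rw [Algebra.smul_def, Algebra.commutes]; rfl
    rw [h, map_smul, hr, smul_smul, Units.inv_mul, one_smul]

/-- The element of the quantum torus corresponding to `x_α`. -/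
def monomial (α : Fin n → ℤ) : (QuantumTorus q)ˣ := (exists_unit_eq_x q c hc α).choose

theorem mk_monomial (α : Fin n → ℤ) :
    QuotientGroup.mk (monomial q c hc α) = monomialClass q α :=
  (exists_unit_eq_x q c hc α).choose_spec.1

theorem toTwisted_monomial (α : Fin n → ℤ) :
    toTwisted q c hc (monomial q c hc α) = TwistedGroupAlgebra.x c α :=
  (exists_unit_eq_x q c hc α).choose_spec.2

/-- Units with the same class differ by a scalar, and this scalar is visible in `k^c Γ` because `x_α
≠ 0`. Identities between such units can thus be checked after `toTwisted` before its injectivity is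
known. -/
theorem eq_smul_monomial (α : Fin n → ℤ) (a : (QuantumTorus q)ˣ) (r : k)
    (ha : QuotientGroup.mk a = monomialClass q α)
    (hr : toTwisted q c hc a = r • TwistedGroupAlgebra.x c α) :
    (a : QuantumTorus q) = r • (monomial q c hc α : QuantumTorus q) := by
  rw [← mk_monomial q c hc, eq_comm, QuotientGroup.eq] at ha
  obtain ⟨s, hs⟩ := mem_scalarUnits.1 ha
  have h : (a : QuantumTorus q) = (s : k) • (monomial q c hc α : QuantumTorus q) := by
    rw [Algebra.smul_def, Algebra.commutes, ← hs, Units.val_mul, Units.mul_inv_cancel_left]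
  rw [h, map_smul, toTwisted_monomial] at hr
  rw [h, TwistedGroupAlgebra.smul_x_injective c hr]

theorem monomial_mul_monomial (α β : Fin n → ℤ) :
    (monomial q c hc α * monomial q c hc β : QuantumTorus q)
      = (c α β : k) • (monomial q c hc (α + β) : QuantumTorus q) := by
  rw [← Units.val_mul]
  apply eq_smul_monomial
  · rw [monomialClass_add, ← mk_monomial q c hc, ← mk_monomial q c hc]; rfl
  · rw [Units.val_mul, map_mul, toTwisted_monomial, toTwisted_monomial,
      TwistedGroupAlgebra.x_mul_x]

/-- The inverse of `toTwisted`, `x_α ↦ monomial α`. -/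
def ofTwisted : TwistedGroupAlgebra c →ₐ[k] QuantumTorus q :=
  AlgHom.ofLinearMap
    ((TwistedGroupAlgebra.basis c).constr k fun α => (monomial q c hc α : QuantumTorus q))
    (by
      rw [TwistedGroupAlgebra.one_def, map_smul, ← TwistedGroupAlgebra.basis_apply,
        Module.Basis.constr_basis]
      have h := eq_smul_monomial q c hc 0 1 (↑(c 0 0)⁻¹ : k) (monomialClass_zero q).symm
        (by rw [Units.val_one, map_one]; rfl)
      exact h.symm)
    (by
      intro a b
      -- Both sides are bilinear in `a` and `b`, so multiplicativity is checked on pairs of basis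
      -- elements.
      refine LinearMap.congr_fun₂ (f := (LinearMap.mul k (TwistedGroupAlgebra c)).compr₂
          ((TwistedGroupAlgebra.basis c).constr k fun α => (monomial q c hc α : QuantumTorus q)))
        (g := (LinearMap.mul k (QuantumTorus q)).compl₁₂
          ((TwistedGroupAlgebra.basis c).constr k fun α => (monomial q c hc α : QuantumTorus q))
          ((TwistedGroupAlgebra.basis c).constr k fun α => (monomial q c hc α : QuantumTorus q)))
        ?_ a b
      refine (TwistedGroupAlgebra.basis c).ext fun α => (TwistedGroupAlgebra.basis c).ext fun β => ?_
      simp only [LinearMap.compr₂_apply, LinearMap.compl₁₂_apply, LinearMap.mul_apply',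
        Module.Basis.constr_basis]
      rw [TwistedGroupAlgebra.basis_apply, TwistedGroupAlgebra.basis_apply,
        TwistedGroupAlgebra.x_mul_x, map_smul, ← TwistedGroupAlgebra.basis_apply,
        Module.Basis.constr_basis, monomial_mul_monomial])

theorem ofTwisted_x (α : Fin n → ℤ) :
    ofTwisted q c hc (TwistedGroupAlgebra.x c α) = monomial q c hc α :=
  (TwistedGroupAlgebra.basis c).constr_basis k _ α

theorem ofTwisted_toTwisted (a : QuantumTorus q) : ofTwisted q c hc (toTwisted q c hc a) = a := by
  have h : (ofTwisted q c hc).comp (toTwisted q c hc) = AlgHom.id k _ :=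
    QuantumTorus.algHom_ext fun i => by
      rw [AlgHom.comp_apply, toTwisted_gen, ofTwisted_x]
      have h := eq_smul_monomial q c hc (Pi.single i 1) (genUnit q i) 1
        (monomialClass_single q i).symm (by rw [one_smul]; exact toTwisted_gen q c hc i)
      rw [one_smul] at h
      exact h.symm
  exact AlgHom.congr_fun h a

theorem toTwisted_ofTwisted (a : TwistedGroupAlgebra c) :
    toTwisted q c hc (ofTwisted q c hc a) = a := by
  have h : (toTwisted q c hc).toLinearMap ∘ₗ (ofTwisted q c hc).toLinearMap = LinearMap.id :=
    (TwistedGroupAlgebra.basis c).ext fun α => by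
      rw [TwistedGroupAlgebra.basis_apply, LinearMap.comp_apply, AlgHom.toLinearMap_apply,
        AlgHom.toLinearMap_apply, ofTwisted_x, toTwisted_monomial, LinearMap.id_apply]
  exact LinearMap.congr_fun h a

/-- The isomorphism `A ≃ k^c Γ`. -/
def toTwistedEquiv : QuantumTorus q ≃ₐ[k] TwistedGroupAlgebra c :=
  { toTwisted q c hc with
    invFun := ofTwisted q c hc
    left_inv := ofTwisted_toTwisted q c hc
    right_inv := toTwisted_ofTwisted q c hc }

theorem toTwisted_bijective : Function.Bijective (toTwisted q c hc) :=
  (toTwistedEquiv q c hc).bijective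

/-- The basis `(x_α)` of the quantum torus. -/
def torusBasis : Module.Basis (Fin n → ℤ) k (QuantumTorus q) :=
  (TwistedGroupAlgebra.basis c).map (toTwistedEquiv q c hc).symm.toLinearEquiv

theorem toTwisted_torusBasis (α : Fin n → ℤ) :
    toTwisted q c hc (torusBasis q c hc α) = TwistedGroupAlgebra.x c α :=
  (toTwistedEquiv q c hc).apply_symm_apply _

theorem torusBasis_mul (α β : Fin n → ℤ) :
    torusBasis q c hc α * torusBasis q c hc β = (c α β : k) • torusBasis q c hc (α + β) := by
  apply (toTwisted_bijective q c hc).1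
  rw [map_mul, map_smul, toTwisted_torusBasis, toTwisted_torusBasis, toTwisted_torusBasis,
    TwistedGroupAlgebra.x_mul_x]

end Identification

end QTorus

end

noncomputable section

namespace QTorus

universe u v w

/-! ### Diagonal operators and changes of cocycle -/

section Diagonal

variable {Γ : Type u} {k : Type v} [Field k]
variable {R : Type w} [Ring R] [Algebra k R] (b : Module.Basis Γ k R)

/-- The diagonal operator `b_α ↦ f(α) b_α`. -/
def diag (f : Γ → k) : R →ₗ[k] R := b.constr k fun α => f α • b α

theorem diag_basis (f : Γ → k) (α : Γ) : diag b f (b α) = f α • b α := b.constr_basis k _ α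

theorem repr_diag (f : Γ → k) (a : R) (α : Γ) : b.repr (diag b f a) α = f α * b.repr a α := by
  have h : (Finsupp.lapply α ∘ₗ b.repr.toLinearMap) ∘ₗ diag b f
      = f α • (Finsupp.lapply α ∘ₗ b.repr.toLinearMap) := b.ext fun β => by
    by_cases hβ : β = α
    · subst hβ; simp [diag_basis]
    · simp [diag_basis, hβ]
  exact LinearMap.congr_fun h a

/-- Only finitely many values of `f` matter for a given element, which is what makes interpolation
possible. -/
theorem diag_congr {f g : Γ → k} {a : R} (h : ∀ α ∈ (b.repr a).support, f α = g α) :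
    diag b f a = diag b g a := by
  apply b.repr.injective
  ext α
  rw [repr_diag, repr_diag]
  by_cases hα : α ∈ (b.repr a).support
  · rw [h α hα]
  · rw [Finsupp.notMem_support_iff.1 hα, mul_zero, mul_zero]

theorem diag_mul (f g : Γ → k) (a : R) : diag b (f * g) a = diag b f (diag b g a) := by
  apply b.repr.injective
  ext α
  simp only [repr_diag, Pi.mul_apply, mul_assoc]

theorem diag_add (f g : Γ → k) (a : R) : diag b (f + g) a = diag b f a + diag b g a := by
  apply b.repr.injective
  ext α
  simp only [repr_diag, Pi.add_apply, add_mul, map_add, Finsupp.add_apply]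

theorem diag_const (r : k) (a : R) : diag b (fun _ => r) a = r • a := by
  apply b.repr.injective
  ext α
  simp only [repr_diag, map_smul, Finsupp.smul_apply, smul_eq_mul]

theorem map_diag {R₁ R₂ : Type*} [Ring R₁] [Ring R₂] [Algebra k R₁] [Algebra k R₂]
    {b₁ : Module.Basis Γ k R₁} {b₂ : Module.Basis Γ k R₂} {Φ : R₁ ≃ₗ[k] R₂} (hΦ : ∀ α, Φ (b₁ α) = b₂ α) (f : Γ → k) (a : R₁) :
    Φ (diag b₁ f a) = diag b₂ f (Φ a) := by
  have h : Φ.toLinearMap ∘ₗ diag b₁ f = diag b₂ f ∘ₗ Φ.toLinearMap := b₁.ext fun α => by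
    simp [diag_basis, hΦ]
  exact LinearMap.congr_fun h a

/-! ### Ideals homogeneous modulo a subgroup -/

variable [AddCommGroup Γ] (S : AddSubgroup Γ)

/-- `f` is constant on the cosets of `S`. -/
def CosetConst (f : Γ → k) : Prop := ∀ α β, α - β ∈ S → f α = f β

/-- The functions constant on the cosets of `S` whose diagonal operators preserve the ideal `I`. -/
def stabilizerAlgebra (I : TwoSidedIdeal R) : Subalgebra k (Γ → k) where
  carrier := {f | CosetConst S f ∧ ∀ a ∈ I, diag b f a ∈ I}
  mul_mem' {f g} hf hg := ⟨fun α β h => by rw [Pi.mul_apply, Pi.mul_apply, hf.1 α β h, hg.1 α β h],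
    fun a ha => by rw [diag_mul]; exact hf.2 _ (hg.2 a ha)⟩
  add_mem' {f g} hf hg := ⟨fun α β h => by rw [Pi.add_apply, Pi.add_apply, hf.1 α β h, hg.1 α β h],
    fun a ha => by rw [diag_add]; exact I.add_mem (hf.2 a ha) (hg.2 a ha)⟩
  algebraMap_mem' r := ⟨fun _ _ _ => rfl, fun a ha => by
    change diag b (fun _ => r) a ∈ I
    rw [diag_const, Algebra.smul_def]
    exact I.mul_mem_left _ _ ha⟩

/-- The ideal `I` is homogeneous for the `Γ ⧸ S`-grading: it is preserved by all diagonal operators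
given by functions constant on the cosets of `S`. -/
def IsCosetHomogeneous (I : TwoSidedIdeal R) : Prop :=
  ∀ f : Γ → k, CosetConst S f → ∀ a ∈ I, diag b f a ∈ I

theorem isCosetHomogeneous_top : IsCosetHomogeneous b S (⊤ : TwoSidedIdeal R) :=
  fun _ _ _ _ => TwoSidedIdeal.mem_top R

variable {b S}

/-- An ideal preserved by enough functions to separate the cosets of `S` is homogeneous. -/
theorem isCosetHomogeneous_of_separates {I : TwoSidedIdeal R}
    (h : ∀ γ δ, γ - δ ∉ S → ∃ f ∈ stabilizerAlgebra b S I, f γ ≠ f δ) :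
    IsCosetHomogeneous b S I := by
  classical
  intro f hf a ha
  have hmk : ∀ γ δ : Γ, γ - δ ∈ S ↔ (QuotientAddGroup.mk γ : Γ ⧸ S) = QuotientAddGroup.mk δ := by
    intro γ δ
    rw [eq_comm, QuotientAddGroup.eq, neg_add_eq_sub]
  -- Lagrange factors: if `g` separates `p` from `t`, then `(g - g(t)) / (g(p) - g(t))` is `1` on
  -- `p` and `0` on `t`. For `p = t` the constant `1` serves.
  have hsep : ∀ p t : Γ ⧸ S, ∃ e ∈ stabilizerAlgebra b S I,
      e p.out = 1 ∧ (p ≠ t → e t.out = 0) := by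
    intro p t
    by_cases hpt : p = t
    · exact ⟨1, one_mem _, rfl, fun h => absurd hpt h⟩
    · obtain ⟨g, hg, hne⟩ := h p.out t.out (by
        rw [hmk, QuotientAddGroup.out_eq', QuotientAddGroup.out_eq']; exact hpt)
      refine ⟨(g p.out - g t.out)⁻¹ • (g - algebraMap k (Γ → k) (g t.out)),
        Subalgebra.smul_mem _ (sub_mem hg (Subalgebra.algebraMap_mem _ _)) _, ?_, fun _ => ?_⟩
      · simp [inv_mul_cancel₀ (sub_ne_zero.2 hne)]
      · simp
  choose e he he1 he0 using hsep
  -- On the finitely many cosets met by the support of `a`, the product `E p` is the indicator of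
  -- `p`, so `g` interpolates `f` there.
  let F : Finset (Γ ⧸ S) := (b.repr a).support.image QuotientAddGroup.mk
  let E : Γ ⧸ S → Γ → k := fun p => ∏ t ∈ F, e p t
  let g : Γ → k := ∑ p ∈ F, f p.out • E p
  have hg : g ∈ stabilizerAlgebra b S I :=
    sum_mem fun p _ => Subalgebra.smul_mem _ (prod_mem fun t _ => he p t) _
  have hout : ∀ α : Γ, α - (QuotientAddGroup.mk α : Γ ⧸ S).out ∈ S := fun α => by
    rw [hmk, QuotientAddGroup.out_eq']
  have hfg : diag b f a = diag b g a := by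
    refine diag_congr b fun α hα => ?_
    have hp : (QuotientAddGroup.mk α : Γ ⧸ S) ∈ F := Finset.mem_image_of_mem _ hα
    rw [hf _ _ (hout α), hg.1 _ _ (hout α)]
    simp only [g, E, Finset.sum_apply, Pi.smul_apply, Finset.prod_apply, smul_eq_mul]
    rw [Finset.sum_eq_single_of_mem _ hp, Finset.prod_eq_one fun t _ => he1 _ t, mul_one]
    intro p _ hne
    rw [Finset.prod_eq_zero hp (he0 _ _ hne), mul_zero]
  rw [hfg]
  exact hg.2 a ha

/-! ### Comparison of products in two algebras with bases indexed by the same group -/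

variable {R₁ R₂ : Type*} [Ring R₁] [Ring R₂] [Algebra k R₁] [Algebra k R₂]
variable {b₁ : Module.Basis Γ k R₁} {b₂ : Module.Basis Γ k R₂} {d₁ d₂ : Γ → Γ → kˣ}
variable {Φ : R₁ ≃ₗ[k] R₂}

/-- A function `d` of two variables which is constant on the cosets of `S` in each of them. -/
def CosetConst₂ (S : AddSubgroup Γ) (d : Γ → Γ → kˣ) : Prop :=
  ∀ α α' β β', α - α' ∈ S → β - β' ∈ S → d α β = d α' β'

/-- The indicator function of a coset of `S`. -/
def cosetIndicator (k : Type v) [Field k] (S : AddSubgroup Γ) (p : Γ ⧸ S) (α : Γ) : k :=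
  open Classical in if (QuotientAddGroup.mk α : Γ ⧸ S) = p then 1 else 0

theorem cosetConst_cosetIndicator (p : Γ ⧸ S) : CosetConst S (cosetIndicator k S p) := by
  intro α β h
  have : (QuotientAddGroup.mk α : Γ ⧸ S) = QuotientAddGroup.mk β := by
    rw [eq_comm, QuotientAddGroup.eq, neg_add_eq_sub]; exact h
  rw [cosetIndicator, cosetIndicator, this]

theorem exists_sum_cosetIndicator (b : Module.Basis Γ k R) (S : AddSubgroup Γ) (a : R) :
    ∃ F : Finset (Γ ⧸ S), a = ∑ p ∈ F, diag b (cosetIndicator k S p) a := by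
  classical
  refine ⟨(b.repr a).support.image QuotientAddGroup.mk, ?_⟩
  apply b.repr.injective
  ext α
  simp only [map_sum, Finsupp.finsetSum_apply, repr_diag, ← Finset.sum_mul]
  by_cases hα : α ∈ (b.repr a).support
  · simp only [cosetIndicator, Finset.sum_ite_eq]
    rw [if_pos (Finset.mem_image_of_mem _ hα), one_mul]
  · rw [Finsupp.notMem_support_iff.1 hα, mul_zero]

/-- Multiplication of an arbitrary element by a homogeneous one, compared in two algebras. -/
theorem map_mul_map_cosetIndicator (hΦ : ∀ α, Φ (b₁ α) = b₂ α)
    (h₁ : ∀ α β, b₁ α * b₁ β = (d₁ α β : k) • b₁ (α + β))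
    (h₂ : ∀ α β, b₂ α * b₂ β = (d₂ α β : k) • b₂ (α + β))
    (hd₁ : CosetConst₂ S d₁) (hd₂ : CosetConst₂ S d₂) (p : Γ ⧸ S) (x y : R₁) :
    Φ x * Φ (diag b₁ (cosetIndicator k S p) y) =
      Φ (diag b₁ (fun α => ((d₂ α p.out / d₁ α p.out : kˣ) : k)) x *
        diag b₁ (cosetIndicator k S p) y) := by
  refine LinearMap.congr_fun₂
    (f := (LinearMap.mul k R₂).compl₁₂ Φ.toLinearMap
      (Φ.toLinearMap ∘ₗ diag b₁ (cosetIndicator k S p)))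
    (g := ((LinearMap.mul k R₁).compl₁₂ (diag b₁ (fun α => ((d₂ α p.out / d₁ α p.out : kˣ) : k)))
      (diag b₁ (cosetIndicator k S p))).compr₂ Φ.toLinearMap) ?_ x y
  refine b₁.ext fun α => b₁.ext fun β => ?_
  simp only [LinearMap.compr₂_apply, LinearMap.compl₁₂_apply, LinearMap.mul_apply',
    LinearMap.comp_apply, LinearEquiv.coe_coe, diag_basis]
  rw [map_smul, smul_mul_smul_comm, map_smul, hΦ, hΦ, mul_smul_comm, h₁, h₂, map_smul, hΦ]
  -- On the coset `p` the index `β` may be replaced by the representative `p.out`, so the correcting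
  -- factor depends on `α` alone. Off `p` both sides vanish.
  by_cases hp : (QuotientAddGroup.mk β : Γ ⧸ S) = p
  · have hβ : β - p.out ∈ S := by
      rw [← neg_add_eq_sub, ← QuotientAddGroup.eq, QuotientAddGroup.out_eq']; exact hp.symm
    have hα : α - α ∈ S := by rw [sub_self]; exact S.zero_mem
    rw [← hd₁ α α β _ hα hβ, ← hd₂ α α β _ hα hβ]
    rw [smul_smul, smul_smul, mul_right_comm, ← Units.val_mul, div_mul_cancel, mul_comm]
  · have h0 : cosetIndicator k S p β = 0 := by rw [cosetIndicator, if_neg hp]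
    simp [h0]

/-- After splitting `y` into coset components, each term pulls back to a diagonal twist of `x` times
a component of `y`; homogeneity keeps the first in `I` and the second in `J`. With `I` or `J` equal
to `⊤` this gives the absorption laws for the transferred ideal. -/
theorem map_mul_map_mem (hΦ : ∀ α, Φ (b₁ α) = b₂ α)
    (h₁ : ∀ α β, b₁ α * b₁ β = (d₁ α β : k) • b₁ (α + β))
    (h₂ : ∀ α β, b₂ α * b₂ β = (d₂ α β : k) • b₂ (α + β))
    (hd₁ : CosetConst₂ S d₁) (hd₂ : CosetConst₂ S d₂) {I J : TwoSidedIdeal R₁}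
    (hI : IsCosetHomogeneous b₁ S I) (hJ : IsCosetHomogeneous b₁ S J) {x y : R₁}
    (hx : x ∈ I) (hy : y ∈ J) : Φ.symm (Φ x * Φ y) ∈ idealMul I J := by
  obtain ⟨F, hF⟩ := exists_sum_cosetIndicator b₁ S y
  rw [hF, map_sum, Finset.mul_sum, map_sum]
  refine sum_mem fun p _ => ?_
  rw [map_mul_map_cosetIndicator hΦ h₁ h₂ hd₁ hd₂, LinearEquiv.symm_apply_apply]
  refine idealMul_le_iff.1 le_rfl _ (hI _ ?_ _ hx) _ (hJ _ (cosetConst_cosetIndicator p) _ hy)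
  -- The twist of `x` must be by a function constant on cosets; this holds because `d₁` and `d₂` are
  -- so in their first variable.
  intro α β h
  have h0 : p.out - p.out ∈ S := by rw [sub_self]; exact S.zero_mem
  simp only [hd₁ α β _ _ h h0, hd₂ α β _ _ h h0]

/-- The image under `Φ` of a homogeneous ideal, as an ideal. -/
def transferIdeal (hΦ : ∀ α, Φ (b₁ α) = b₂ α)
    (h₁ : ∀ α β, b₁ α * b₁ β = (d₁ α β : k) • b₁ (α + β))
    (h₂ : ∀ α β, b₂ α * b₂ β = (d₂ α β : k) • b₂ (α + β))
    (hd₁ : CosetConst₂ S d₁) (hd₂ : CosetConst₂ S d₂) (I : TwoSidedIdeal R₁)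
    (hI : IsCosetHomogeneous b₁ S I) : TwoSidedIdeal R₂ :=
  TwoSidedIdeal.mk' {x | Φ.symm x ∈ I}
    (by rw [Set.mem_ofPred_eq, map_zero]; exact I.zero_mem)
    (fun hx hy => by rw [Set.mem_ofPred_eq, map_add]; exact I.add_mem hx hy)
    (fun hx => by rw [Set.mem_ofPred_eq, map_neg]; exact I.neg_mem hx)
    (fun {x y} hy => by
      have h := map_mul_map_mem hΦ h₁ h₂ hd₁ hd₂ (isCosetHomogeneous_top b₁ S) hI
        (TwoSidedIdeal.mem_top R₁ (x := Φ.symm x)) hy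
      rw [LinearEquiv.apply_symm_apply, LinearEquiv.apply_symm_apply] at h
      exact idealMul_le_iff.2 (fun a _ c hc => I.mul_mem_left a c hc) h)
    (fun {x y} hx => by
      have h := map_mul_map_mem hΦ h₁ h₂ hd₁ hd₂ hI (isCosetHomogeneous_top b₁ S)
        hx (TwoSidedIdeal.mem_top R₁ (x := Φ.symm y))
      rw [LinearEquiv.apply_symm_apply, LinearEquiv.apply_symm_apply] at h
      exact idealMul_le_iff.2 (fun a ha c _ => I.mul_mem_right a c ha) h)

section transfer

variable (hΦ : ∀ α, Φ (b₁ α) = b₂ α)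
  (h₁ : ∀ α β, b₁ α * b₁ β = (d₁ α β : k) • b₁ (α + β))
  (h₂ : ∀ α β, b₂ α * b₂ β = (d₂ α β : k) • b₂ (α + β))
  (hd₁ : CosetConst₂ S d₁) (hd₂ : CosetConst₂ S d₂)

theorem mem_transferIdeal {I : TwoSidedIdeal R₁} {hI : IsCosetHomogeneous b₁ S I} {x : R₂} :
    x ∈ transferIdeal hΦ h₁ h₂ hd₁ hd₂ I hI ↔ Φ.symm x ∈ I :=
  TwoSidedIdeal.mem_mk' ..

theorem isCosetHomogeneous_transferIdeal {I : TwoSidedIdeal R₁}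
    (hI : IsCosetHomogeneous b₁ S I) :
    IsCosetHomogeneous b₂ S (transferIdeal hΦ h₁ h₂ hd₁ hd₂ I hI) := by
  intro f hf a ha
  rw [mem_transferIdeal] at ha ⊢
  have h := hI f hf _ ha
  rwa [← Φ.symm_apply_apply (diag b₁ f _), map_diag hΦ, Φ.apply_symm_apply] at h

/-- Homogeneity of the product is needed for its image to be an ideal at all. -/
theorem idealMul_transferIdeal_le {I J : TwoSidedIdeal R₁} (hI : IsCosetHomogeneous b₁ S I)
    (hJ : IsCosetHomogeneous b₁ S J) (hIJ : IsCosetHomogeneous b₁ S (idealMul I J)) :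
    idealMul (transferIdeal hΦ h₁ h₂ hd₁ hd₂ I hI) (transferIdeal hΦ h₁ h₂ hd₁ hd₂ J hJ) ≤
      transferIdeal hΦ h₁ h₂ hd₁ hd₂ (idealMul I J) hIJ := by
  rw [idealMul_le_iff]
  intro a ha b hb
  rw [mem_transferIdeal] at *
  have h := map_mul_map_mem hΦ h₁ h₂ hd₁ hd₂ hI hJ ha hb
  rwa [Φ.apply_symm_apply, Φ.apply_symm_apply] at h

end transfer

end Diagonal

end QTorus

end

noncomputable section

namespace QTorus

universe u v

/-! ### Homeomorphisms of spectra induced by lattice isomorphisms -/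

section Spectra

variable {R : Type u} [Ring R] {R' : Type v} [Ring R'] {L : CompleteSublattice (TwoSidedIdeal R')}
  (e : TwoSidedIdeal R ≃o L)

theorem coe_orderIso_eq_top_iff {I : TwoSidedIdeal R} : (e I : TwoSidedIdeal R') = ⊤ ↔ I = ⊤ := by
  rw [← CompleteSublattice.coe_top (L := L), Subtype.coe_inj, map_eq_top_iff]

/-- Relative primality is expressed by the order, the top element and products alone, and each
member of `L` is the image of an ideal of `R`. -/
theorem isPrimeIn_orderIso_iff
    (hmul : ∀ I J, (e (idealMul I J) : TwoSidedIdeal R') = idealMul (e I : TwoSidedIdeal R') (e J))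
    (P : TwoSidedIdeal R) :
    IsPrimeIn L (e P : TwoSidedIdeal R') ↔ IsPrimeIn ⊤ P := by
  constructor
  · intro h
    refine ⟨trivial, fun hP => h.ne_top ((coe_orderIso_eq_top_iff e).2 hP),
      fun I _ J _ hIJ => ?_⟩
    have := h.le_or_le _ (e I).2 _ (e J).2 (by
      rw [← hmul]; exact e.monotone hIJ)
    exact this.imp e.le_iff_le.1 e.le_iff_le.1
  · intro h
    refine ⟨(e P).2, fun hP => h.ne_top ((coe_orderIso_eq_top_iff e).1 hP),
      fun I hI J hJ hIJ => ?_⟩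
    obtain ⟨I', hI'⟩ := e.surjective ⟨I, hI⟩
    obtain ⟨J', hJ'⟩ := e.surjective ⟨J, hJ⟩
    obtain rfl : (e I' : TwoSidedIdeal R') = I := congrArg Subtype.val hI'
    obtain rfl : (e J' : TwoSidedIdeal R') = J := congrArg Subtype.val hJ'
    rw [← hmul] at hIJ
    have := h.le_or_le I' trivial J' trivial (e.le_iff_le.1 hIJ)
    exact this.imp (fun h => e.monotone h) (fun h => e.monotone h)

theorem isMaxIn_orderIso_iff (M : TwoSidedIdeal R) :
    IsMaxIn L (e M : TwoSidedIdeal R') ↔ IsMaxIn ⊤ M := by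
  constructor
  · intro h
    refine ⟨trivial, fun hM => h.ne_top ((coe_orderIso_eq_top_iff e).2 hM), fun J _ hJ => ?_⟩
    exact (coe_orderIso_eq_top_iff e).1 (h.eq_top_of_lt _ (e J).2 (e.strictMono hJ))
  · intro h
    refine ⟨(e M).2, fun hM => h.ne_top ((coe_orderIso_eq_top_iff e).1 hM), fun J hJ hlt => ?_⟩
    obtain ⟨J', hJ'⟩ := e.surjective ⟨J, hJ⟩
    obtain rfl : (e J' : TwoSidedIdeal R') = J := congrArg Subtype.val hJ'
    exact (coe_orderIso_eq_top_iff e).2 (h.eq_top_of_lt J' trivial (e.lt_iff_lt.1 hlt))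

/-- The homeomorphism of prime spectra induced by a lattice isomorphism preserving products. -/
def primeSpecHomeomorph
    (hmul : ∀ I J, (e (idealMul I J) : TwoSidedIdeal R') = idealMul (e I : TwoSidedIdeal R') (e J)) :
    Spec R ≃ₜ PrimeSpec L where
  toFun P := ⟨e P.1, (isPrimeIn_orderIso_iff e hmul P.1).2 P.2⟩
  invFun Q := ⟨e.symm ⟨Q.1, Q.2.mem⟩, (isPrimeIn_orderIso_iff e hmul _).1 (by
    rw [e.apply_symm_apply]; exact Q.2)⟩
  left_inv P := Subtype.ext (e.symm_apply_apply P.1)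
  right_inv Q := by
    apply Subtype.ext
    change (e (e.symm ⟨Q.1, Q.2.mem⟩) : TwoSidedIdeal R') = Q.1
    rw [e.apply_symm_apply]
  continuous_toFun := by
    refine continuous_iff_isClosed.2 fun Z hZ => ?_
    obtain ⟨I, rfl⟩ := PrimeSpec.isClosed_iff.1 hZ
    -- The ideal `I` need not belong to `L`. A member of `L` contains `I` exactly when it contains
    -- the smallest member of `L` above `I`, and that one can be pulled back.
    let K : L := ⟨sInf {K | K ∈ L ∧ I ≤ K}, L.sInfClosed' fun K hK => hK.1⟩
    refine PrimeSpec.isClosed_iff.2 ⟨e.symm K, ?_⟩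
    ext P
    change I ≤ (e P.1 : TwoSidedIdeal R') ↔ e.symm K ≤ P.1
    rw [e.symm_apply_le]
    constructor
    · intro h
      exact (sInf_le ⟨(e P.1).2, h⟩ : sInf {K | K ∈ L ∧ I ≤ K} ≤ (e P.1 : TwoSidedIdeal R'))
    · intro h
      exact (le_sInf fun K hK => hK.2 : I ≤ (K : TwoSidedIdeal R')).trans h
  continuous_invFun := by
    refine continuous_iff_isClosed.2 fun Z hZ => ?_
    obtain ⟨I, rfl⟩ := PrimeSpec.isClosed_iff.1 hZ
    refine PrimeSpec.isClosed_iff.2 ⟨e I, ?_⟩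
    ext Q
    change I ≤ e.symm ⟨Q.1, Q.2.mem⟩ ↔ (e I : TwoSidedIdeal R') ≤ Q.1
    rw [e.le_symm_apply]
    rfl

/-- The homeomorphism of maximal spectra induced by a lattice isomorphism preserving products. -/
def maxSpecHomeomorph
    (hmul : ∀ I J, (e (idealMul I J) : TwoSidedIdeal R') = idealMul (e I : TwoSidedIdeal R') (e J)) :
    MaxIdeals R ≃ₜ MaxSpec L where
  toFun M := ⟨e M.1, (isMaxIn_orderIso_iff e M.1).2 M.2⟩
  invFun N := ⟨e.symm ⟨N.1, N.2.mem⟩, (isMaxIn_orderIso_iff e _).1 (by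
    rw [e.apply_symm_apply]; exact N.2)⟩
  left_inv M := Subtype.ext (e.symm_apply_apply M.1)
  right_inv N := by
    apply Subtype.ext
    change (e (e.symm ⟨N.1, N.2.mem⟩) : TwoSidedIdeal R') = N.1
    rw [e.apply_symm_apply]
  continuous_toFun := continuous_induced_rng.2
    ((primeSpecHomeomorph e hmul).continuous.comp
      (continuous_induced_dom (f := MaxSpec.toPrimeSpec)))
  continuous_invFun := continuous_induced_rng.2
    ((primeSpecHomeomorph e hmul).symm.continuous.comp
      (continuous_induced_dom (f := MaxSpec.toPrimeSpec)))

end Spectra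

end QTorus

end

noncomputable section

namespace QTorus

universe u

/-! ### The pairing `σ` and the ideals of the quantum torus -/

section Correspondence

variable {k : Type u} [Field k] {n : ℕ}

/-- The basis `(y_α)` of the group algebra. -/
def groupAlgBasis (k : Type u) [Field k] (n : ℕ) : Module.Basis (Fin n → ℤ) k (GroupAlg k n) :=
  AddMonoidAlgebra.basis (Fin n → ℤ) k

theorem groupAlgBasis_apply (α : Fin n → ℤ) : groupAlgBasis k n α = y k α := by
  simp [groupAlgBasis, y]

theorem groupAlgBasis_mul (α β : Fin n → ℤ) : groupAlgBasis k n α * groupAlgBasis k n β =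
    (((fun _ _ => 1 : (Fin n → ℤ) → (Fin n → ℤ) → kˣ) α β : kˣ) : k) •
      groupAlgBasis k n (α + β) := by
  simp only [groupAlgBasis_apply, y_mul_y, Units.val_one, one_smul]

theorem actGroupAlg_eq_diag (h : CharTorus k n) (a : GroupAlg k n) :
    actGroupAlg k n h a = diag (groupAlgBasis k n) (fun α => (pairing h α : k)) a := by
  have H : (actGroupAlg k n h).toLinearMap
      = diag (groupAlgBasis k n) (fun α => (pairing h α : k)) :=
    (groupAlgBasis k n).ext fun α => by
      rw [diag_basis, groupAlgBasis_apply]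
      exact groupAlgHom_y h α
  exact LinearMap.congr_fun H a

theorem pairing_add (h : CharTorus k n) (α β : Fin n → ℤ) :
    pairing h (α + β) = pairing h α * pairing h β :=
  map_mul h (Multiplicative.ofAdd α) (Multiplicative.ofAdd β)

theorem sigma_add_left (q : Fin n → Fin n → kˣ) (α β γ : Fin n → ℤ) :
    sigma q (α + β) γ = sigma q α γ * sigma q β γ := by
  simp [sigma, add_mul, zpow_add, Finset.prod_mul_distrib]

theorem sigma_add_right (q : Fin n → Fin n → kˣ) (α β γ : Fin n → ℤ) :
    sigma q α (β + γ) = sigma q α β * sigma q α γ := by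
  simp [sigma, mul_add, zpow_add, Finset.prod_mul_distrib]

/-- The character `σ(β, -)`. -/
def sigmaChar (q : Fin n → Fin n → kˣ) (β : Fin n → ℤ) : CharTorus k n where
  toFun α := sigma q β α.toAdd
  map_one' := by simp [sigma]
  map_mul' α α' := sigma_add_right q β _ _

theorem pairing_sigmaChar (q : Fin n → Fin n → kˣ) (β α : Fin n → ℤ) :
    pairing (sigmaChar q β) α = sigma q β α := rfl

theorem cosetConst_pairing {S : AddSubgroup (Fin n → ℤ)} {h : CharTorus k n} (hh : h ∈ perp S) :
    CosetConst S (fun α => (pairing h α : k)) := by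
  intro α β hαβ
  have := pairing_add h (α - β) β
  rw [sub_add_cancel, hh _ hαβ, one_mul] at this
  exact congrArg Units.val this

/-! ### Separation of cosets by `σ`, and the resulting homogeneity of ideals -/

variable (q : Fin n → Fin n → kˣ) (c : TwoCocycle (Fin n → ℤ) k)
  (hc : ∀ α β, c α β * (c β α)⁻¹ = sigma q α β)

-- Antisymmetry of `σ` follows from its being the commutator of `c`.
include hc in
theorem sigma_swap (α β : Fin n → ℤ) : sigma q β α = (sigma q α β)⁻¹ := by
  rw [← hc, ← hc, mul_inv, inv_inv, mul_comm]

-- The radical is defined through the first argument of `σ`; antisymmetry moves it to the second.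
include hc in
theorem sigmaChar_mem_perp (β : Fin n → ℤ) : sigmaChar q β ∈ perp (rad q) := by
  intro α hα
  rw [pairing_sigmaChar, sigma_swap q c hc, hα β, inv_one]

include hc in
/-- The characters `σ(β, -)` separate the cosets of the radical. -/
theorem exists_sigma_ne {γ δ : Fin n → ℤ} (h : γ - δ ∉ rad q) :
    ∃ β, sigma q β γ ≠ sigma q β δ := by
  by_contra! H
  refine h fun β => ?_
  have h1 := sigma_add_left q (γ - δ) δ β
  rw [sub_add_cancel, sigma_swap q c hc β γ, sigma_swap q c hc β δ, H] at h1
  exact right_eq_mul.1 h1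

include hc in
/-- An ideal preserved by the characters `σ(β, -)` is homogeneous modulo the radical. -/
theorem isCosetHomogeneous_of_sigma {R : Type*} [Ring R] [Algebra k R]
    {b : Module.Basis (Fin n → ℤ) k R} {I : TwoSidedIdeal R}
    (h : ∀ β, ∀ a ∈ I, diag b (fun α => (sigma q β α : k)) a ∈ I) :
    IsCosetHomogeneous b (rad q) I :=
  isCosetHomogeneous_of_separates fun γ δ hγδ => by
    obtain ⟨β, hβ⟩ := exists_sigma_ne q c hc hγδ
    exact ⟨fun α => (sigma q β α : k),
      ⟨cosetConst_pairing (sigmaChar_mem_perp q c hc β), h β⟩, fun h => hβ (Units.ext h)⟩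

-- Elements of `S^⊥` are constant on cosets, so homogeneity implies stability. Conversely, the
-- `σ(β,-)` in `S^⊥` already separate the cosets, so stability under them alone forces homogeneity.
include hc in
theorem mem_stableIdeals_iff (J : TwoSidedIdeal (GroupAlg k n)) :
    J ∈ stableIdeals (actGroupAlg k n) (perp (rad q)) ↔
      IsCosetHomogeneous (groupAlgBasis k n) (rad q) J := by
  constructor
  · intro hJ
    refine isCosetHomogeneous_of_sigma q c hc fun β a ha => ?_
    have h := hJ _ (sigmaChar_mem_perp q c hc β)
    rw [← h, mem_imageIdeal]
    have h' := actGroupAlg_eq_diag (sigmaChar q β) a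
    simp only [pairing_sigmaChar] at h'
    rwa [← h', AlgEquiv.symm_apply_apply]
  · intro hJ g hg
    have key : ∀ g ∈ perp (k := k) (rad q), ∀ a ∈ J, actGroupAlg k n g a ∈ J := fun g hg a ha => by
      rw [actGroupAlg_eq_diag]
      exact hJ _ (cosetConst_pairing hg) a ha
    ext x
    rw [mem_imageIdeal]
    constructor
    · intro hx
      have := key g hg _ hx
      rwa [AlgEquiv.apply_symm_apply] at this
    · intro hx
      have := key g⁻¹ (inv_mem hg) _ hx
      exact this

/-- Linear extension of `x_β x_α = σ(β,α) x_α x_β`: conjugation by `x_β` is a diagonal operator. -/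
theorem torusBasis_mul_eq_diag (β : Fin n → ℤ) (a : QuantumTorus q) :
    torusBasis q c hc β * a =
      diag (torusBasis q c hc) (fun α => (sigma q β α : k)) a * torusBasis q c hc β := by
  have h : LinearMap.mulLeft k (torusBasis q c hc β) =
      LinearMap.mulRight k (torusBasis q c hc β) ∘ₗ
        diag (torusBasis q c hc) (fun α => (sigma q β α : k)) :=
    (torusBasis q c hc).ext fun α => by
      rw [LinearMap.comp_apply, diag_basis, LinearMap.mulLeft_apply, LinearMap.mulRight_apply,
        smul_mul_assoc, torusBasis_mul, torusBasis_mul, smul_smul, ← Units.val_mul, ← hc,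
        inv_mul_cancel_right, add_comm]
  exact LinearMap.congr_fun h a

/-- Conjugation by the unit `x_β` preserves every two-sided ideal and acts diagonally by `σ(β,-)`,
so all ideals of `A` are homogeneous. -/
theorem isCosetHomogeneous_torus (I : TwoSidedIdeal (QuantumTorus q)) :
    IsCosetHomogeneous (torusBasis q c hc) (rad q) I := by
  refine isCosetHomogeneous_of_sigma q c hc fun β a ha => ?_
  have h : torusBasis q c hc β *
      ((↑((c β (-β))⁻¹ * (c 0 0)⁻¹) : k) • torusBasis q c hc (-β)) = 1 := by
    apply (toTwisted_bijective q c hc).1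
    rw [map_mul, map_smul, toTwisted_torusBasis, toTwisted_torusBasis, map_one]
    exact TwistedGroupAlgebra.x_mul_x_neg c β
  have h' := I.mul_mem_right _ ((↑((c β (-β))⁻¹ * (c 0 0)⁻¹) : k) • torusBasis q c hc (-β))
    (I.mul_mem_left (torusBasis q c hc β) _ ha)
  rwa [torusBasis_mul_eq_diag, mul_assoc, h, mul_one] at h'

/-- `Φ_c` as a linear equivalence. -/
def phiEquiv : QuantumTorus q ≃ₗ[k] GroupAlg k n :=
  (torusBasis q c hc).equiv (groupAlgBasis k n) (Equiv.refl _)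

theorem phiEquiv_basis (α : Fin n → ℤ) :
    phiEquiv q c hc (torusBasis q c hc α) = groupAlgBasis k n α := by
  simp [phiEquiv]

theorem Phi_eq (a : QuantumTorus q) : Phi q c hc a = phiEquiv q c hc a := by
  have h : Phi q c hc = (phiEquiv q c hc).toLinearMap := (torusBasis q c hc).ext fun α => by
    rw [LinearEquiv.coe_coe, phiEquiv_basis, Phi, LinearMap.comp_apply, AlgHom.toLinearMap_apply,
      toTwisted_torusBasis, ← TwistedGroupAlgebra.basis_apply, Module.Basis.constr_basis,
      groupAlgBasis_apply]
  exact LinearMap.congr_fun h a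

/-- The action is defined on generators only. The diagonal operator of a character is itself an
algebra endomorphism, so agreement on the generators suffices. -/
theorem actTorus_eq_diag (h : CharTorus k n) (a : QuantumTorus q) :
    actTorus q h a = diag (torusBasis q c hc) (fun α => (pairing h α : k)) a := by
  let f : QuantumTorus q →ₐ[k] QuantumTorus q :=
    AlgHom.ofLinearMap (diag (torusBasis q c hc) (fun α => (pairing h α : k)))
      (by
        have h1 : (1 : QuantumTorus q) = (↑(c 0 0)⁻¹ : k) • torusBasis q c hc 0 := by
          apply (toTwisted_bijective q c hc).1
          rw [map_one, map_smul, toTwisted_torusBasis]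
          rfl
        have h0 : pairing h 0 = 1 := map_one h
        rw [h1, map_smul, diag_basis, h0, Units.val_one, one_smul])
      (by
        intro a a'
        refine LinearMap.congr_fun₂
          (f := (LinearMap.mul k (QuantumTorus q)).compr₂
            (diag (torusBasis q c hc) (fun α => (pairing h α : k))))
          (g := (LinearMap.mul k (QuantumTorus q)).compl₁₂
            (diag (torusBasis q c hc) (fun α => (pairing h α : k)))
            (diag (torusBasis q c hc) (fun α => (pairing h α : k)))) ?_ a a'
        refine (torusBasis q c hc).ext fun α => (torusBasis q c hc).ext fun β => ?_
        simp only [LinearMap.compr₂_apply, LinearMap.compl₁₂_apply, LinearMap.mul_apply',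
          diag_basis]
        rw [smul_mul_smul_comm, torusBasis_mul, map_smul, diag_basis, pairing_add, Units.val_mul,
          smul_comm])
  have hf : torusHom q h = f := QuantumTorus.algHom_ext fun i => by
    have hgen : QuantumTorus.gen q i = torusBasis q c hc (Pi.single i 1) := by
      apply (toTwisted_bijective q c hc).1
      rw [toTwisted_gen, toTwisted_torusBasis]
    rw [torusHom_gen, hgen]
    exact (diag_basis (torusBasis q c hc) (fun α => (pairing h α : k)) (Pi.single i 1)).symm
  exact AlgHom.congr_fun hf a

theorem Phi_bijective : Function.Bijective (Phi q c hc) := by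
  rw [show ⇑(Phi q c hc) = phiEquiv q c hc from funext (Phi_eq q c hc)]
  exact (phiEquiv q c hc).bijective

theorem Phi_actTorus (h : CharTorus k n) (a : QuantumTorus q) :
    Phi q c hc (actTorus q h a) = actGroupAlg k n h (Phi q c hc a) := by
  rw [Phi_eq, Phi_eq, actTorus_eq_diag q c hc, actGroupAlg_eq_diag,
    map_diag (phiEquiv_basis q c hc)]

/-! ### The ideal correspondence for a cocycle trivial on `S × Γ` -/

variable (hS : ∀ α ∈ rad q, ∀ β, c α β = 1)

include hc hS in
/-- A cocycle trivial on `S × Γ` is constant on the cosets of `S` in both variables. -/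
theorem cosetConst₂_cocycle : CosetConst₂ (rad q) c := by
  -- For `s ∈ S` the relation `σ(s,β) = 1` says `c(s,β) = c(β,s)`, so the normalisation also holds
  -- in the second variable.
  have hS' : ∀ α ∈ rad q, ∀ β, c β α = 1 := fun α hα β => by
    have h := hc α β
    rw [hα β, hS α hα, one_mul, inv_eq_one] at h
    exact h
  -- The cocycle identity with `s` in the first place, and below with `s` in the last, leaves only
  -- the claimed equality once the values of `c` involving `s` alone as an argument are `1`.
  have hl : ∀ s ∈ rad q, ∀ α β, c (s + α) β = c α β := fun s hs α β => by
    have h := c.cocycle s α β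
    rwa [hS s hs, hS s hs, one_mul, mul_one] at h
  have hr : ∀ s ∈ rad q, ∀ α β, c α (β + s) = c α β := fun s hs α β => by
    have h := c.cocycle α β s
    rw [hS' s hs, hS' s hs, one_mul, mul_one] at h
    exact h.symm
  intro α α' β β' hα hβ
  rw [← hl _ hα α' β', ← hr _ hβ (α - α' + α') β', sub_add_cancel, add_sub_cancel]

theorem cosetConst₂_one (S : AddSubgroup (Fin n → ℤ)) :
    CosetConst₂ S (fun _ _ => 1 : (Fin n → ℤ) → (Fin n → ℤ) → kˣ) :=
  fun _ _ _ _ _ _ => rfl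

theorem phiEquiv_symm_basis (α : Fin n → ℤ) :
    (phiEquiv q c hc).symm (groupAlgBasis k n α) = torusBasis q c hc α := by
  rw [← phiEquiv_basis q c hc, LinearEquiv.symm_apply_apply]

/-- `Φ_c(I)`, as an ideal. -/
def phiIdeal (I : TwoSidedIdeal (QuantumTorus q)) : TwoSidedIdeal (GroupAlg k n) :=
  transferIdeal (phiEquiv_basis q c hc) (torusBasis_mul q c hc) groupAlgBasis_mul
    (cosetConst₂_cocycle q c hc hS) (cosetConst₂_one _) I (isCosetHomogeneous_torus q c hc I)

/-- `Φ_c⁻¹(J)`, as an ideal. -/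
def phiSymmIdeal (J : TwoSidedIdeal (GroupAlg k n))
    (hJ : IsCosetHomogeneous (groupAlgBasis k n) (rad q) J) : TwoSidedIdeal (QuantumTorus q) :=
  transferIdeal (phiEquiv_symm_basis q c hc) groupAlgBasis_mul (torusBasis_mul q c hc)
    (cosetConst₂_one _) (cosetConst₂_cocycle q c hc hS) J hJ

theorem mem_phiIdeal {I : TwoSidedIdeal (QuantumTorus q)} {x : GroupAlg k n} :
    x ∈ phiIdeal q c hc hS I ↔ (phiEquiv q c hc).symm x ∈ I :=
  mem_transferIdeal ..

theorem mem_phiSymmIdeal {J : TwoSidedIdeal (GroupAlg k n)}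
    {hJ : IsCosetHomogeneous (groupAlgBasis k n) (rad q) J} {a : QuantumTorus q} :
    a ∈ phiSymmIdeal q c hc hS J hJ ↔ phiEquiv q c hc a ∈ J :=
  mem_transferIdeal ..

theorem isCosetHomogeneous_phiIdeal (I : TwoSidedIdeal (QuantumTorus q)) :
    IsCosetHomogeneous (groupAlgBasis k n) (rad q) (phiIdeal q c hc hS I) :=
  isCosetHomogeneous_transferIdeal (phiEquiv_basis q c hc) (torusBasis_mul q c hc)
    groupAlgBasis_mul (cosetConst₂_cocycle q c hc hS) (cosetConst₂_one _)
    (isCosetHomogeneous_torus q c hc I)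

/-- The lattice isomorphism `I ↦ Φ_c(I)`. -/
def phiOrderIso :
    TwoSidedIdeal (QuantumTorus q) ≃o stableIdeals (actGroupAlg k n) (perp (rad q)) where
  toFun I := ⟨phiIdeal q c hc hS I,
    (mem_stableIdeals_iff q c hc _).2 (isCosetHomogeneous_phiIdeal q c hc hS I)⟩
  invFun J := phiSymmIdeal q c hc hS J.1 ((mem_stableIdeals_iff q c hc _).1 J.2)
  left_inv I := by
    ext a
    rw [mem_phiSymmIdeal, mem_phiIdeal, LinearEquiv.symm_apply_apply]
  right_inv J := by
    apply Subtype.ext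
    ext x
    rw [mem_phiIdeal, mem_phiSymmIdeal, LinearEquiv.apply_symm_apply]
  map_rel_iff' {I J} := by
    constructor
    · intro h a ha
      have h' : phiEquiv q c hc a ∈ phiIdeal q c hc hS J := h (by
        change phiEquiv q c hc a ∈ phiIdeal q c hc hS I
        rwa [mem_phiIdeal, LinearEquiv.symm_apply_apply])
      rwa [mem_phiIdeal, LinearEquiv.symm_apply_apply] at h'
    · intro h x hx
      have hx' : x ∈ phiIdeal q c hc hS I := hx
      change x ∈ phiIdeal q c hc hS J
      rw [mem_phiIdeal] at hx' ⊢
      exact h hx'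

theorem mem_phiOrderIso {I : TwoSidedIdeal (QuantumTorus q)} {x : GroupAlg k n} :
    x ∈ (phiOrderIso q c hc hS I : TwoSidedIdeal (GroupAlg k n)) ↔
      (phiEquiv q c hc).symm x ∈ I :=
  mem_phiIdeal q c hc hS

theorem coe_phiOrderIso (I : TwoSidedIdeal (QuantumTorus q)) :
    ((phiOrderIso q c hc hS I : TwoSidedIdeal (GroupAlg k n)) : Set (GroupAlg k n)) =
      Phi q c hc '' (I : Set (QuantumTorus q)) := by
  ext x
  rw [SetLike.mem_coe, mem_phiOrderIso]
  constructor
  · intro h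
    exact ⟨_, h, by rw [Phi_eq, LinearEquiv.apply_symm_apply]⟩
  · rintro ⟨a, ha, rfl⟩
    rwa [Phi_eq, LinearEquiv.symm_apply_apply]

theorem coe_phiOrderIso_symm (J : stableIdeals (actGroupAlg k n) (perp (rad q))) :
    ((phiOrderIso q c hc hS).symm J : Set (QuantumTorus q)) =
      Phi q c hc ⁻¹' ((J : TwoSidedIdeal (GroupAlg k n)) : Set (GroupAlg k n)) := by
  ext a
  rw [Set.mem_preimage, Phi_eq]
  exact mem_phiSymmIdeal q c hc hS (hJ := (mem_stableIdeals_iff q c hc _).1 J.2)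

/-- One inclusion is the transfer of products along `Φ_c`, the other the same transfer along
`Φ_c⁻¹`. -/
theorem phiOrderIso_idealMul (I J : TwoSidedIdeal (QuantumTorus q)) :
    (phiOrderIso q c hc hS (idealMul I J) : TwoSidedIdeal (GroupAlg k n)) =
      idealMul (phiOrderIso q c hc hS I : TwoSidedIdeal (GroupAlg k n))
        (phiOrderIso q c hc hS J) := by
  have hle : ∀ I J, idealMul (phiOrderIso q c hc hS I : TwoSidedIdeal (GroupAlg k n))
      (phiOrderIso q c hc hS J) ≤ phiOrderIso q c hc hS (idealMul I J) := fun I J =>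
    idealMul_transferIdeal_le (phiEquiv_basis q c hc) (torusBasis_mul q c hc) groupAlgBasis_mul
      (cosetConst₂_cocycle q c hc hS) (cosetConst₂_one _) (isCosetHomogeneous_torus q c hc I)
      (isCosetHomogeneous_torus q c hc J) (isCosetHomogeneous_torus q c hc _)
  refine le_antisymm ?_ (hle I J)
  intro x hx
  rw [mem_phiOrderIso] at hx
  -- Automorphisms respect products, so a product of stable ideals is stable; hence its preimage
  -- under `Φ_c` is an ideal of `A`, and it is enough to test that ideal on the products generating
  -- `I J`.
  have hhom : IsCosetHomogeneous (groupAlgBasis k n) (rad q)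
      (idealMul (phiOrderIso q c hc hS I : TwoSidedIdeal (GroupAlg k n))
        (phiOrderIso q c hc hS J)) := by
    refine (mem_stableIdeals_iff q c hc _).1 fun g hg => ?_
    rw [imageIdeal_idealMul, (phiOrderIso q c hc hS I).2 g hg, (phiOrderIso q c hc hS J).2 g hg]
  have h : idealMul I J ≤ phiSymmIdeal q c hc hS _ hhom := by
    rw [idealMul_le_iff]
    intro a ha b hb
    have h := map_mul_map_mem (phiEquiv_symm_basis q c hc) groupAlgBasis_mul
      (torusBasis_mul q c hc) (cosetConst₂_one _) (cosetConst₂_cocycle q c hc hS)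
      (isCosetHomogeneous_phiIdeal q c hc hS I) (isCosetHomogeneous_phiIdeal q c hc hS J)
      (x := phiEquiv q c hc a) (y := phiEquiv q c hc b)
      (by rwa [mem_phiIdeal, LinearEquiv.symm_apply_apply])
      (by rwa [mem_phiIdeal, LinearEquiv.symm_apply_apply])
    rw [LinearEquiv.symm_apply_apply, LinearEquiv.symm_apply_apply, LinearEquiv.symm_symm] at h
    rw [mem_phiSymmIdeal]
    exact h
  have hx' := h hx
  rwa [mem_phiSymmIdeal, LinearEquiv.apply_symm_apply] at hx'

theorem phiOrderIso_imageIdeal (h : CharTorus k n) (I : TwoSidedIdeal (QuantumTorus q)) :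
    (phiOrderIso q c hc hS (imageIdeal (actTorus q h) I) : TwoSidedIdeal (GroupAlg k n)) =
      imageIdeal (actGroupAlg k n h) (phiOrderIso q c hc hS I) := by
  apply SetLike.coe_injective
  rw [coe_phiOrderIso, coe_imageIdeal, coe_imageIdeal, coe_phiOrderIso, Set.image_image,
    Set.image_image]
  exact Set.image_congr fun a _ => Phi_actTorus q c hc h a

end Correspondence

end QTorus

end

open QTorus in
theorem proposition3p9 {k : Type*} [Field k] [IsAlgClosed k] {n : ℕ}
    (q : Fin n → Fin n → kˣ) (hq : IsMulAntisymm q)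
    (c : TwoCocycle (Fin n → ℤ) k)
    (hc : ∀ α β, c α β * (c β α)⁻¹ = sigma q α β)
    (hS : ∀ α ∈ rad q, ∀ β, c α β = 1) :
    -- the identification of `A` with the twisted group algebra, and the properties of `Φ_c`
    Function.Bijective (toTwisted q c hc) ∧
    Function.Bijective (Phi q c hc) ∧
    (∀ (h : CharTorus k n) (a : QuantumTorus q),
      Phi q c hc (actTorus q h a) = actGroupAlg k n h (Phi q c hc a)) ∧
    -- the lattice isomorphism
    (∃ e : TwoSidedIdeal (QuantumTorus q) ≃o stableIdeals (actGroupAlg k n) (perp (rad q)),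
      (∀ I, ((e I : TwoSidedIdeal (GroupAlg k n)) : Set (GroupAlg k n)) =
        Phi q c hc '' (I : Set (QuantumTorus q))) ∧
      (∀ J, (e.symm J : Set (QuantumTorus q)) =
        Phi q c hc ⁻¹' ((J : TwoSidedIdeal (GroupAlg k n)) : Set (GroupAlg k n))) ∧
      (∀ I J, (e (idealMul I J) : TwoSidedIdeal (GroupAlg k n)) =
        idealMul (e I : TwoSidedIdeal (GroupAlg k n)) (e J)) ∧
      (∀ (h : CharTorus k n) I, (e (imageIdeal (actTorus q h) I) : TwoSidedIdeal (GroupAlg k n)) =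
        imageIdeal (actGroupAlg k n h) (e I))) ∧
    -- the homeomorphism of prime spectra
    (∃ e : Spec (QuantumTorus q) ≃ₜ PrimeSpec (stableIdeals (actGroupAlg k n) (perp (rad q))),
      (∀ P, ((e P).1 : Set (GroupAlg k n)) = Phi q c hc '' (P.1 : Set (QuantumTorus q))) ∧
      (∀ Q, ((e.symm Q).1 : Set (QuantumTorus q)) =
        Phi q c hc ⁻¹' (Q.1 : Set (GroupAlg k n))) ∧
      (∀ (h : CharTorus k n) P, e (P.act (actTorus q h) (imageIdeal_mem_top _)) =
        (e P).act (actGroupAlg k n h) (imageIdeal_mem_stableIdeals _ _ h))) ∧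
    -- the homeomorphism of maximal spectra
    (∃ e : MaxIdeals (QuantumTorus q) ≃ₜ MaxSpec (stableIdeals (actGroupAlg k n) (perp (rad q))),
      (∀ P, ((e P).1 : Set (GroupAlg k n)) = Phi q c hc '' (P.1 : Set (QuantumTorus q))) ∧
      (∀ Q, ((e.symm Q).1 : Set (QuantumTorus q)) =
        Phi q c hc ⁻¹' (Q.1 : Set (GroupAlg k n))) ∧
      (∀ (h : CharTorus k n) P, e (P.act (actTorus q h) (imageIdeal_mem_top _)) =
        (e P).act (actGroupAlg k n h) (imageIdeal_mem_stableIdeals _ _ h))) := by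
  refine ⟨toTwisted_bijective q c hc, Phi_bijective q c hc, Phi_actTorus q c hc,
    ⟨phiOrderIso q c hc hS, coe_phiOrderIso q c hc hS, coe_phiOrderIso_symm q c hc hS,
      phiOrderIso_idealMul q c hc hS, phiOrderIso_imageIdeal q c hc hS⟩,
    ⟨primeSpecHomeomorph (phiOrderIso q c hc hS) (phiOrderIso_idealMul q c hc hS),
      fun P => coe_phiOrderIso q c hc hS P.1,
      fun Q => coe_phiOrderIso_symm q c hc hS ⟨Q.1, Q.2.mem⟩,
      fun h P => Subtype.ext (phiOrderIso_imageIdeal q c hc hS h P.1)⟩,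
    ⟨maxSpecHomeomorph (phiOrderIso q c hc hS) (phiOrderIso_idealMul q c hc hS),
      fun M => coe_phiOrderIso q c hc hS M.1,
      fun N => coe_phiOrderIso_symm q c hc hS ⟨N.1, N.2.mem⟩,
      fun h M => Subtype.ext (phiOrderIso_imageIdeal q c hc hS h M.1)⟩⟩
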